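/- For positive integers $k_1,\dots,k_d$ with $k_d\ge 2$ put $\zeta(k_1,\dots,k_d)=\sum_{0<n_1<\cdots<n_d}n_1^{-k_1}\cdots n_d^{-k_d}$ (a multiple zeta value of weight $k_1+\cdots+k_d$ and depth $d$), and for integers $k\ge2$, $r\ge0$ put $$Z(k,r)=\sum_{j\ge0}\ \sum_{\substack{(r_1,\dots,r_j)\in\{1,2\}^j\\ r_1+\cdots+r_j=r}}2^{\#\{i\,:\,r_i=1\}}\,\zeta(r_1,\dots,r_j,k).$$ For $p\in\mathbb{Z}$ and $r\in\mathbb{Z}_{\ge0}$ define rational numbers $C(p,q,r)$ by the identity of formal power series $$\sum_{q\ge r+1}C(p,q,r)\,y^{q-1}=\frac{2+y}{(1-y)^{p+1}}\left(\frac{1-\sqrt{1-4y}}{2}\right)^r .$$ For $s,t,u\in\mathbb{C}$ with $s+t+u=0$ let $$V(s,t,u)=\frac{\Gamma(1+s)\,\Gamma(1+t)\,\Gamma(1+u)}{\Gamma(1-s)\,\Gamma(1-t)\,\Gamma(1-u)}$$ be the Virasoro function, and put $S=s^2+st+t^2$, $T=-stu$. Theorem. For $(s,t,u)$ near the origin with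 $s+t+u=0$, $V$ has a convergent expansion $$V(s,t,u)=1+\sum_{p\ge0,\ q\ge1}e_{p,q}\,S^pT^q,$$ whose coefficients $e_{p,q}$ are uniquely determined. For all $p\ge0$ and $q\ge1$, the number $e_{p,q}$ is an integral linear combination of multiple zeta values of weight $2p+3q$ and depth at most $q$ whose last argument (the exponent of the largest summation variable) is larger than $2p+2q$ and whose other arguments are all equal to $1$ or $2$. More precisely, $$e_{p,q}=\sum_{r=0}^{q-1}(-1)^r\,C(p,q,r)\,Z(2p+3q-r,\,r),$$ and the coefficients $C(p,q,r)$ occurring here are integers. -/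

import Mathlib

open scoped PowerSeries Topology

noncomputable section

namespace Virasoro

/-- The closed-string (Virasoro) function
`Γ(1+s) Γ(1+t) Γ(1+u) / (Γ(1-s) Γ(1-t) Γ(1-u))`, used on the plane `s + t + u = 0`. -/
def Vcl (s t u : ℂ) : ℂ :=
  (Complex.Gamma (1 + s) * Complex.Gamma (1 + t) * Complex.Gamma (1 + u)) /
    (Complex.Gamma (1 - s) * Complex.Gamma (1 - t) * Complex.Gamma (1 - u))

/-- `e` is the family of Taylor coefficients at the origin of the Virasoro function, viewed as a
function of `S = s² + st + t²` and `T = -stu`: for all `(s, t, u)` near the origin with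
`s + t + u = 0`, the double series `∑ e_{p,q} S^p T^q` converges (unconditionally) to it. -/
def IsTaylorCoeffs (e : ℕ → ℕ → ℂ) : Prop :=
  ∃ ε : ℝ, 0 < ε ∧ ∀ s t u : ℂ, s + t + u = 0 → ‖s‖ < ε → ‖t‖ < ε → ‖u‖ < ε →
    HasSum (fun x : ℕ × ℕ => e x.1 x.2 * (s ^ 2 + s * t + t ^ 2) ^ x.1 * (-(s * t * u)) ^ x.2)
      (Vcl s t u)

/-- The multiple zeta value
`ζ(k₁, …, k_d) = ∑_{0 < n₁ < ⋯ < n_d} n₁^{-k₁} ⋯ n_d^{-k_d}`. -/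
def mzv (k : List ℕ) : ℝ :=
  ∑' n : {n : Fin k.length → ℕ // StrictMono n ∧ ∀ i, 0 < n i},
    ∏ i : Fin k.length, ((n.1 i : ℝ) ^ (k.get i))⁻¹

/-- `Z(k, r)`: the sum over all tuples `(r₁, …, r_j)`, `j ≥ 0`, with entries in `{1, 2}` and sum `r`
of `2 ^ #{i : r_i = 1} * ζ(r₁, …, r_j, k)`. -/
def Z (k r : ℕ) : ℝ :=
  ∑ c : Composition r with ∀ a ∈ c.blocks, a = 1 ∨ a = 2,
    (2 : ℝ) ^ (c.blocks.count 1) * mzv (c.blocks ++ [k])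

/-- The formal power series `√(1 - 4y)`, as the binomial series `∑ binom(1/2, n) (-4y)^n`. -/
def sqrtSeries : ℚ⟦X⟧ :=
  PowerSeries.rescale (-4 : ℚ) (PowerSeries.binomialSeries ℚ (1 / 2 : ℚ))

theorem sqrtSeries_sq : sqrtSeries ^ 2 = 1 - 4 * PowerSeries.X := by
  have h : PowerSeries.binomialSeries ℚ (1 / 2 : ℚ) * PowerSeries.binomialSeries ℚ (1 / 2 : ℚ) =
      1 + PowerSeries.X := by
    rw [← PowerSeries.binomialSeries_add]
    simpa [show (2⁻¹ : ℚ) + 2⁻¹ = 1 by norm_num] using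
      PowerSeries.binomialSeries_nat (R := ℚ) (A := ℚ) 1
  rw [sqrtSeries, sq, ← map_mul, h]
  ext n
  rw [PowerSeries.coeff_rescale, show (4 : ℚ⟦X⟧) = PowerSeries.C (4 : ℚ) from rfl]
  rcases n with _ | _ | n <;> simp [PowerSeries.coeff_X, PowerSeries.coeff_one]

theorem constantCoeff_sqrtSeries : PowerSeries.constantCoeff sqrtSeries = 1 := by
  rw [sqrtSeries, ← PowerSeries.coeff_zero_eq_constantCoeff_apply, PowerSeries.coeff_rescale]
  simp

/-- `1 - y` as a unit of the ring of formal power series. -/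
def oneSubUnit : ℚ⟦X⟧ˣ where
  val := 1 - PowerSeries.X
  inv := (1 - PowerSeries.X)⁻¹
  val_inv := PowerSeries.mul_inv_cancel _ (by simp)
  inv_val := PowerSeries.inv_mul_cancel _ (by simp)

/-- The generating function `(2 + y) / (1 - y)^{p+1} * ((1 - √(1 - 4y)) / 2)^r`. -/
def genC (p : ℤ) (r : ℕ) : ℚ⟦X⟧ :=
  (2 + PowerSeries.X) * ((oneSubUnit ^ (-(p + 1)) : ℚ⟦X⟧ˣ) : ℚ⟦X⟧) *
    (PowerSeries.C (1 / 2 : ℚ) * (1 - sqrtSeries)) ^ r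

/-- `C(p, q, r)` for `q ≥ 1`: the coefficient of `y^{q-1}` in the generating function. -/
def C (p : ℤ) (q r : ℕ) : ℚ := PowerSeries.coeff (q - 1) (genC p r)

/-- The multiple zeta values of weight `2p+3q` and depth at most `q` whose last argument (the
exponent of the largest summation variable) exceeds `2p+2q`, all others being `1` or `2`. -/
def specialMZVs (p q : ℕ) : Set ℂ :=
  {z | ∃ (l : List ℕ) (k : ℕ), (∀ a ∈ l, a = 1 ∨ a = 2) ∧ l.sum + k = 2 * p + 3 * q ∧
    l.length + 1 ≤ q ∧ 2 * p + 2 * q < k ∧ z = (mzv (l ++ [k]) : ℂ)}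

end Virasoro

end

/-! Euler's limit for Gamma gives `V = ∏ (n-s)(n-t)(n-u) / ((n+s)(n+t)(n+u))` over `n ≥ 1`. As
`s+t+u = 0`, the denominators are `n³ - nS - T`, the numerators `n³ - nS + T`, and the factors are
`1 + (2T/n) / (n² - T/n - S)`. For fixed `T` these have simple poles in `S`, so each finite product
splits into partial fractions, and dominated convergence gives such an expansion of `V`
(`tendsto_prod_one_add`).

The residue at `S = n² - T/n` is computable. There the cubic `m³ - mS - T` in `m` has the roots `n,
-a, -b` with `a + b = n` and `nab = T`; that is, `a = nx`, where `x(1-x) = y = T/n³` and `x =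
(1-√(1-4y))/2`. Since `a + b` is the integer `n`, the product over `m ≠ n` telescopes to `(2+y)/2 ·
∏_{m<n} (1 - a/m)²` (`prod_residueFactor`, `tendsto_prod_pole`).

Three expansions then give the formula. The coefficients of `∏_{m<n} (1 + X/m)²` are the weighted
truncated zeta sums in `Z` (`sum_onesTwos_harmonicSum`). The geometric series in `S/n²` produces the
powers of `(1-y)⁻¹`. The series of `(2+y)(1-y)^{-p-1} x^r` defines `C`, and is integral because `x`
is the Catalan series times `y`. Absolute convergence (`summable_expTerm`) permits collecting `S^p
T^q`; the sum over `n` is then `Z(2p+3q-r, r)`.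

Uniqueness holds because `(S, T)` covers a neighbourhood of the origin (`exists_parameters`). -/

open scoped ENNReal

noncomputable section

namespace Virasoro

open Filter

/-! ### Multiple zeta values as iterated sums -/

/-- Strictly increasing `d`-tuples of positive integers bounded by `N`. -/
def BoundedTuple (d : ℕ) (N : ℕ∞) : Type :=
  {n : Fin d → ℕ // (StrictMono n ∧ ∀ i, 0 < n i) ∧ ∀ i, (n i : ℕ∞) ≤ N}

/-- Splitting off the last entry of a tuple. -/
def boundedTupleSuccEquiv (d : ℕ) (N : ℕ∞) :
    BoundedTuple (d + 1) N ≃ Σ m : {m : ℕ // ((m + 1 : ℕ) : ℕ∞) ≤ N}, BoundedTuple d (m.1 : ℕ∞) where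
  -- The largest entry is recorded as `m + 1`, so that the strict bound on the other entries becomes
  -- `≤ m`.
  toFun n := ⟨⟨n.1 (Fin.last d) - 1, by
      rw [Nat.sub_add_cancel (n.2.1.2 _)]; exact n.2.2 _⟩,
    ⟨fun i => n.1 i.castSucc,
      ⟨fun i j h => n.2.1.1 (Fin.castSucc_lt_castSucc_iff.2 h), fun i => n.2.1.2 _⟩, fun i => by
        have h := n.2.1.1 (Fin.castSucc_lt_last i)
        have : n.1 i.castSucc ≤ n.1 (Fin.last d) - 1 := by omega
        exact_mod_cast this⟩⟩
  invFun x := ⟨Fin.snoc (α := fun _ => ℕ) x.2.1 (x.1.1 + 1), by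
    obtain ⟨⟨m, hm⟩, n, ⟨h1, h2⟩, h3⟩ := x
    have h3' : ∀ i, n i ≤ m := fun i => by exact_mod_cast h3 i
    refine ⟨⟨?_, ?_⟩, ?_⟩
    · rw [Fin.strictMono_iff_lt_succ]
      intro i
      rcases Fin.eq_castSucc_or_eq_last i.succ with ⟨j, hj⟩ | hj
      · rw [hj, Fin.snoc_castSucc, Fin.snoc_castSucc]
        apply h1
        rw [Fin.lt_def]
        have := congrArg Fin.val hj
        simp at this
        omega
      · rw [hj, Fin.snoc_castSucc, Fin.snoc_last]
        exact Nat.lt_succ_of_le (h3' i)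
    · intro i
      refine Fin.lastCases ?_ (fun j => ?_) i
      · simp
      · simpa using h2 j
    · intro i
      refine Fin.lastCases ?_ (fun j => ?_) i
      · simpa using hm
      · rw [Fin.snoc_castSucc]
        refine le_trans ?_ hm
        exact_mod_cast (h3' j).trans (Nat.le_succ m)⟩
  left_inv n := by
    apply Subtype.ext
    funext i
    refine Fin.lastCases ?_ (fun j => ?_) i
    · simp only [Fin.snoc_last]
      exact Nat.sub_add_cancel (n.2.1.2 _)
    · simp
  right_inv x := by
    have key : ∀ a b : Σ m : {m : ℕ // ((m + 1 : ℕ) : ℕ∞) ≤ N}, BoundedTuple d (m.1 : ℕ∞),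
        a.1.1 = b.1.1 → a.2.1 = b.2.1 → a = b := by
      rintro ⟨⟨m, hm⟩, n, h⟩ ⟨⟨m', hm'⟩, n', h'⟩ h1 h2
      dsimp only at h1 h2
      subst h1 h2
      rfl
    refine key _ _ ?_ ?_
    · simp
    · funext i
      simp

/-- The nested sum `∑ ∏ n_i^{-k_i}` over bounded tuples. -/
def nestedSum (d : ℕ) (k : Fin d → ℕ) (N : ℕ∞) : ℝ≥0∞ :=
  ∑' n : BoundedTuple d N, ENNReal.ofReal (∏ i, ((n.1 i : ℝ) ^ k i)⁻¹)

/-- Fubini over the largest entry; with values in `ℝ≥0∞` no summability has to be checked. -/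
theorem nestedSum_succ (d : ℕ) (k : Fin (d + 1) → ℕ) (N : ℕ∞) :
    nestedSum (d + 1) k N = ∑' m : {m : ℕ // ((m + 1 : ℕ) : ℕ∞) ≤ N},
      ENNReal.ofReal (((m.1 + 1 : ℝ) ^ k (Fin.last d))⁻¹) *
        nestedSum d (fun i => k i.castSucc) (m.1 : ℕ∞) := by
  unfold nestedSum
  rw [← (boundedTupleSuccEquiv d N).symm.tsum_eq, ENNReal.tsum_sigma']
  refine tsum_congr fun m => ?_
  rw [← ENNReal.tsum_mul_left]
  refine tsum_congr fun n => ?_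
  change ENNReal.ofReal (∏ i, (((Fin.snoc (α := fun _ => ℕ) n.1 (m.1 + 1) i : ℕ) : ℝ) ^ k i)⁻¹) = _
  rw [← ENNReal.ofReal_mul (by positivity), Fin.prod_univ_castSucc, mul_comm]
  simp only [Fin.snoc_castSucc, Fin.snoc_last, Nat.cast_add, Nat.cast_one]

theorem nestedSum_zero (k : Fin 0 → ℕ) (N : ℕ∞) : nestedSum 0 k N = 1 := by
  unfold nestedSum
  have : Unique (BoundedTuple 0 N) :=
    { default := ⟨Fin.elim0, ⟨fun i => i.elim0, fun i => i.elim0⟩, fun i => i.elim0⟩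
      uniq := fun a => Subtype.ext (funext fun i => i.elim0) }
  rw [tsum_eq_single this.default (fun b hb => absurd (this.uniq b) hb)]
  simp

theorem mzv_eq_toReal_nestedSum (k : List ℕ) : mzv k = (nestedSum k.length k.get ⊤).toReal := by
  unfold nestedSum mzv
  rw [ENNReal.tsum_toReal_eq (fun _ => ENNReal.ofReal_ne_top)]
  let E : BoundedTuple k.length ⊤ ≃ {n : Fin k.length → ℕ // StrictMono n ∧ ∀ i, 0 < n i} :=
    Equiv.subtypeEquivRight fun n => by simp
  rw [← E.tsum_eq]
  refine tsum_congr fun n => ?_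
  rw [ENNReal.toReal_ofReal (Finset.prod_nonneg fun _ _ => by positivity)]
  rfl

theorem nestedSum_cast (k : List ℕ) (d : ℕ) (h : k.length = d) (N : ℕ∞) :
    nestedSum k.length k.get N = nestedSum d (fun i => k.get (i.cast h.symm)) N := by
  subst h; rfl

/-- Reversed lists have the exponent of the largest variable at the head, which makes the recursion
structural. -/
theorem mzv_reverse (l : List ℕ) :
    mzv l.reverse = (nestedSum l.length (fun i => l.get i.rev) ⊤).toReal := by
  rw [mzv_eq_toReal_nestedSum, nestedSum_cast _ l.length (by simp)]
  congr 2
  funext i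
  simp only [List.get_eq_getElem, List.getElem_reverse, Fin.val_cast, Fin.val_rev]
  congr 1
  omega

theorem nestedSum_reverse_cons (a : ℕ) (l : List ℕ) (N : ℕ∞) :
    nestedSum (a :: l).length (fun i => (a :: l).get i.rev) N =
      ∑' m : {m : ℕ // ((m + 1 : ℕ) : ℕ∞) ≤ N}, ENNReal.ofReal (((m.1 + 1 : ℝ) ^ a)⁻¹) *
        nestedSum l.length (fun i => l.get i.rev) (m.1 : ℕ∞) := by
  refine (nestedSum_succ l.length _ N).trans (tsum_congr fun m => ?_)
  congr 2
  · simp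
  · funext i
    simp [Fin.rev_castSucc]

/-- The truncated nested sum `∑ ∏ n_i^{-k_i}` over `0 < n_1 < ⋯ < n_d ≤ n`, where the list of
exponents starts with that of the largest variable. -/
def harmonicSum : List ℕ → ℕ → ℝ
  | [], _ => 1
  | a :: l, n => ∑ m ∈ Finset.range n, ((m + 1 : ℝ) ^ a)⁻¹ * harmonicSum l m

theorem harmonicSum_nonneg (l : List ℕ) (n : ℕ) : 0 ≤ harmonicSum l n := by
  induction l generalizing n with
  | nil => simp [harmonicSum]
  | cons a l ih => exact Finset.sum_nonneg fun m _ => mul_nonneg (by positivity) (ih m)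

theorem harmonicSum_le (l : List ℕ) (n : ℕ) : harmonicSum l n ≤ (n : ℝ) ^ l.length := by
  induction l generalizing n with
  | nil => simp [harmonicSum]
  | cons a l ih =>
    calc harmonicSum (a :: l) n ≤ ∑ m ∈ Finset.range n, (n : ℝ) ^ l.length := by
          refine Finset.sum_le_sum fun m hm => ?_
          have h1 : ((m + 1 : ℝ) ^ a)⁻¹ ≤ 1 :=
            inv_le_one_of_one_le₀ (one_le_pow₀ (by linarith [(Nat.cast_nonneg m : (0 : ℝ) ≤ m)]))
          have h2 : harmonicSum l m ≤ (n : ℝ) ^ l.length :=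
            (ih m).trans (by gcongr; exact (Finset.mem_range.1 hm).le)
          calc _ ≤ 1 * harmonicSum l m := by
                gcongr
                exact harmonicSum_nonneg l m
            _ ≤ _ := by linarith
      _ = _ := by simp [pow_succ, mul_comm]

theorem nestedSum_eq_harmonicSum (l : List ℕ) (n : ℕ) :
    nestedSum l.length (fun i => l.get i.rev) (n : ℕ∞) = ENNReal.ofReal (harmonicSum l n) := by
  induction l generalizing n with
  | nil => simp [harmonicSum, nestedSum_zero]
  | cons a l ih =>
    rw [nestedSum_reverse_cons, harmonicSum, ENNReal.ofReal_sum_of_nonneg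
      (fun m _ => mul_nonneg (by positivity) (harmonicSum_nonneg l m))]
    rw [← Finset.tsum_subtype]
    let E : {m : ℕ // ((m + 1 : ℕ) : ℕ∞) ≤ n} ≃ {m : ℕ // m ∈ Finset.range n} :=
      Equiv.subtypeEquivRight fun m => by
        rw [Finset.mem_range, Nat.cast_le, Nat.succ_le_iff]
    rw [← E.tsum_eq]
    refine tsum_congr fun m => ?_
    rw [ENNReal.ofReal_mul (by positivity)]
    rw [ih m.1]
    rfl

/-- The truncated sum is at most `n ^ l.length`, so the hypothesis on `k` leaves a majorant
`1/(n+1)²`. The last argument is always large enough for this crude bound. -/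
theorem hasSum_mzv (l : List ℕ) (k : ℕ) (hk : l.length + 2 ≤ k) :
    HasSum (fun n : ℕ => ((n + 1 : ℝ) ^ k)⁻¹ * harmonicSum l n) (mzv (l.reverse ++ [k])) := by
  have hnn : ∀ n : ℕ, 0 ≤ ((n + 1 : ℝ) ^ k)⁻¹ * harmonicSum l n := fun n =>
    mul_nonneg (by positivity) (harmonicSum_nonneg l n)
  have hs : Summable (fun n : ℕ => ((n + 1 : ℝ) ^ k)⁻¹ * harmonicSum l n) := by
    have h2 : Summable (fun n : ℕ => (((n + 1 : ℕ) : ℝ) ^ 2)⁻¹) :=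
      (summable_nat_add_iff 1).2 (Real.summable_nat_pow_inv.2 (by norm_num))
    refine Summable.of_nonneg_of_le hnn (fun n => ?_) h2
    have hn : (1 : ℝ) ≤ n + 1 := by linarith [(Nat.cast_nonneg n : (0 : ℝ) ≤ n)]
    rw [inv_mul_le_iff₀ (by positivity), ← div_eq_mul_inv, le_div_iff₀ (by positivity)]
    push_cast
    calc harmonicSum l n * ((n : ℝ) + 1) ^ 2 ≤ ((n : ℝ) + 1) ^ l.length * ((n : ℝ) + 1) ^ 2 := by
          gcongr
          exact (harmonicSum_le l n).trans (by gcongr; linarith)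
      _ = ((n : ℝ) + 1) ^ (l.length + 2) := (pow_add _ _ _).symm
      _ ≤ _ := pow_le_pow_right₀ hn hk
  convert hs.hasSum using 1
  rw [show l.reverse ++ [k] = (k :: l).reverse by simp, mzv_reverse,
    nestedSum_reverse_cons]
  let E : ℕ ≃ {m : ℕ // ((m + 1 : ℕ) : ℕ∞) ≤ ⊤} :=
    (Equiv.subtypeUnivEquiv (fun _ => le_top)).symm
  rw [← E.tsum_eq, ENNReal.tsum_toReal_eq]
  · refine tsum_congr fun n => ?_
    rw [← ENNReal.toReal_ofReal (hnn n), ENNReal.ofReal_mul (by positivity),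
      ← nestedSum_eq_harmonicSum]
    rfl
  · intro n
    refine ENNReal.mul_ne_top ENNReal.ofReal_ne_top ?_
    rw [nestedSum_eq_harmonicSum]
    exact ENNReal.ofReal_ne_top

/-! ### Words in 1 and 2 as coefficients of a product of squares -/

/-- The lists with entries in `{1, 2}` and sum `r`. -/
def onesTwos : ℕ → Finset (List ℕ)
  | 0 => {[]}
  | 1 => {[1]}
  | r + 2 => (onesTwos (r + 1)).image (List.cons 1) ∪ (onesTwos r).image (List.cons 2)

theorem mem_onesTwos (r : ℕ) (l : List ℕ) :
    l ∈ onesTwos r ↔ (∀ a ∈ l, a = 1 ∨ a = 2) ∧ l.sum = r := by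
  induction r using Nat.strong_induction_on generalizing l with
  | _ r ih =>
    match r with
    | 0 =>
      rcases l with _ | ⟨a, l⟩
      · simp [onesTwos]
      · simp [onesTwos]
        intro h _ h'
        omega
    | 1 =>
      rcases l with _ | ⟨a, l⟩
      · simp [onesTwos]
      · have h0 := ih 0 (by omega) l
        simp only [onesTwos, Finset.mem_singleton, List.cons.injEq, List.mem_cons, forall_eq_or_imp,
          List.sum_cons] at h0 ⊢
        constructor
        · rintro ⟨rfl, rfl⟩; simp
        · rintro ⟨⟨h1, h2⟩, h3⟩
          exact ⟨by omega, h0.2 ⟨h2, by omega⟩⟩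
    | r + 2 =>
      rcases l with _ | ⟨a, l⟩
      · simp [onesTwos]
      · have h0 := ih r (by omega) l
        have h1 := ih (r + 1) (by omega) l
        simp only [onesTwos, Finset.mem_union, Finset.mem_image, List.cons.injEq, List.mem_cons,
          forall_eq_or_imp, List.sum_cons]
        constructor
        · rintro (⟨l', h, rfl, rfl⟩ | ⟨l', h, rfl, rfl⟩)
          · have := h1.1 h
            exact ⟨⟨Or.inl rfl, this.1⟩, by omega⟩
          · have := h0.1 h
            exact ⟨⟨Or.inr rfl, this.1⟩, by omega⟩
        · rintro ⟨⟨rfl | rfl, h2⟩, h3⟩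
          · exact Or.inl ⟨l, h1.2 ⟨h2, by omega⟩, rfl, rfl⟩
          · exact Or.inr ⟨l, h0.2 ⟨h2, by omega⟩, rfl, rfl⟩

theorem sum_onesTwos_succ_succ (r : ℕ) (f : List ℕ → ℝ) :
    ∑ l ∈ onesTwos (r + 2), f l =
      ∑ l ∈ onesTwos (r + 1), f (1 :: l) + ∑ l ∈ onesTwos r, f (2 :: l) := by
  rw [onesTwos, Finset.sum_union, Finset.sum_image, Finset.sum_image]
  · intro a _ b _ h; simpa using h
  · intro a _ b _ h; simpa using h
  · rw [Finset.disjoint_left]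
    intro l h1 h2
    simp only [Finset.mem_image] at h1 h2
    obtain ⟨a, -, rfl⟩ := h1
    obtain ⟨b, -, h⟩ := h2
    simp at h

/-- The polynomial `∏_{1 ≤ m ≤ n} (1 + X / m)²`. -/
def sqProd (n : ℕ) : Polynomial ℝ :=
  ∏ m ∈ Finset.range n, (1 + Polynomial.C ((m + 1 : ℝ)⁻¹) * Polynomial.X) ^ 2

theorem sqProd_succ (n : ℕ) : sqProd (n + 1) = sqProd n +
    Polynomial.C (2 * (n + 1 : ℝ)⁻¹) * (sqProd n * Polynomial.X) +
    Polynomial.C (((n + 1 : ℝ) ^ 2)⁻¹) * (sqProd n * Polynomial.X ^ 2) := by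
  rw [sqProd, Finset.prod_range_succ, ← sqProd, ← inv_pow]
  simp only [Polynomial.C_mul, Polynomial.C_pow, Polynomial.C_ofNat]
  ring

theorem coeff_sqProd_nonneg (n r : ℕ) : 0 ≤ (sqProd n).coeff r := by
  induction n generalizing r with
  | zero => simp only [sqProd, Finset.range_zero, Finset.prod_empty, Polynomial.coeff_one]; split_ifs <;> norm_num
  | succ n ih =>
    rw [sqProd_succ]
    simp only [Polynomial.coeff_add, Polynomial.coeff_C_mul]
    have h1 : 0 ≤ (sqProd n * Polynomial.X).coeff r := by
      rcases r with _ | r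
      · simp
      · rw [Polynomial.coeff_mul_X]; exact ih r
    have h2 : 0 ≤ (sqProd n * Polynomial.X ^ 2).coeff r := by
      rw [Polynomial.coeff_mul_X_pow']; split_ifs
      · exact ih _
      · exact le_rfl
    have := ih r
    positivity

/-- Passing from `n` to `n + 1` multiplies the product by `1 + 2X/(n+1) + X²/(n+1)²`. The three
terms record that the value `n + 1` is unused, used with exponent 1 (weight 2), or used with
exponent 2. -/
theorem sum_onesTwos_harmonicSum (n r : ℕ) :
    ∑ l ∈ onesTwos r, (2 : ℝ) ^ l.count 1 * harmonicSum l n = (sqProd n).coeff r := by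
  induction n generalizing r with
  | zero =>
    match r with
    | 0 => simp [onesTwos, harmonicSum, sqProd]
    | 1 => simp [onesTwos, harmonicSum, sqProd, Polynomial.coeff_one]
    | r + 2 => rw [sum_onesTwos_succ_succ]; simp [harmonicSum, sqProd, Polynomial.coeff_one]
  | succ n ih =>
    rw [sqProd_succ]
    simp only [Polynomial.coeff_add, Polynomial.coeff_C_mul]
    have hs : ∀ a l, harmonicSum (a :: l) (n + 1) =
        harmonicSum (a :: l) n + ((n + 1 : ℝ) ^ a)⁻¹ * harmonicSum l n := fun a l => by
      simp [harmonicSum, Finset.sum_range_succ]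
    match r with
    | 0 => rw [← ih]; simp [onesTwos, harmonicSum]
    | 1 =>
      rw [← ih, Polynomial.coeff_mul_X, ← ih, Polynomial.coeff_mul_X_pow']
      simp [onesTwos, hs]
      simp [harmonicSum]
      ring
    | r + 2 =>
      rw [Polynomial.coeff_mul_X, Polynomial.coeff_mul_X_pow, ← ih (r + 2), ← ih (r + 1), ← ih r,
        sum_onesTwos_succ_succ, sum_onesTwos_succ_succ, Finset.mul_sum, Finset.mul_sum]
      simp only [hs, mul_add, Finset.sum_add_distrib]
      have e1 : ∀ l : List ℕ, (2 : ℝ) ^ (1 :: l).count 1 * (((n + 1 : ℝ) ^ 1)⁻¹ * harmonicSum l n) =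
          2 * (n + 1 : ℝ)⁻¹ * (2 ^ l.count 1 * harmonicSum l n) := fun l => by
        rw [List.count_cons_self]; ring
      have e2 : ∀ l : List ℕ, (2 : ℝ) ^ (2 :: l).count 1 * (((n + 1 : ℝ) ^ 2)⁻¹ * harmonicSum l n) =
          ((n + 1 : ℝ) ^ 2)⁻¹ * (2 ^ l.count 1 * harmonicSum l n) := fun l => by
        rw [List.count_cons_of_ne (by norm_num)]; ring
      simp only [e1, e2]
      ring

theorem Z_eq_sum_onesTwos (k r : ℕ) :
    Z k r = ∑ l ∈ onesTwos r, (2 : ℝ) ^ l.count 1 * mzv (l.reverse ++ [k]) := by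
  unfold Z
  refine Finset.sum_bij (fun c _ => c.blocks.reverse) ?_ ?_ ?_ ?_
  · intro c hc
    rw [mem_onesTwos]
    exact ⟨fun a ha => (Finset.mem_filter.1 hc).2 a (by simpa using ha), by simp⟩
  · intro c _ c' _ h
    exact Composition.ext (List.reverse_injective h)
  · intro l hl
    rw [mem_onesTwos] at hl
    refine ⟨⟨l.reverse, fun {i} hi => ?_, by simpa using hl.2⟩, ?_, by simp⟩
    · rcases hl.1 i (by simpa using hi) with h | h <;> omega
    · simpa using hl.1
  · intro c _
    simp

theorem hasSum_Z (k r : ℕ) (hk : r + 2 ≤ k) :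
    HasSum (fun n : ℕ => ((n + 1 : ℝ) ^ k)⁻¹ * (sqProd n).coeff r) (Z k r) := by
  rw [Z_eq_sum_onesTwos]
  have : (fun n : ℕ => ((n + 1 : ℝ) ^ k)⁻¹ * (sqProd n).coeff r) = fun n : ℕ =>
      ∑ l ∈ onesTwos r, (2 : ℝ) ^ l.count 1 * (((n + 1 : ℝ) ^ k)⁻¹ * harmonicSum l n) := by
    funext n
    rw [← sum_onesTwos_harmonicSum, Finset.mul_sum]
    exact Finset.sum_congr rfl fun l _ => by ring
  rw [this]
  refine hasSum_sum fun l hl => (hasSum_mzv l k ?_).mul_left _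
  rw [mem_onesTwos] at hl
  have : l.length ≤ l.sum := List.length_le_sum_of_one_le l fun a ha => by
    rcases hl.1 a ha with h | h <;> omega
  omega

/-! ### Integrality of the coefficients C(p,q,r) -/

/-- The natural power series `(2 + X) (1 - X)^{-(p+1)} (∑ catalan k X^{k+1})^r`. -/
def natGen (p r : ℕ) : ℕ⟦X⟧ :=
  (PowerSeries.C 2 + PowerSeries.X) * (PowerSeries.mk 1) ^ (p + 1) *
    (PowerSeries.X * PowerSeries.catalanSeries) ^ r

theorem half_one_sub_sqrtSeries :
    PowerSeries.C (1 / 2 : ℚ) * (1 - sqrtSeries) =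
      PowerSeries.map (Nat.castRingHom ℚ) (PowerSeries.X * PowerSeries.catalanSeries) := by
  set f := PowerSeries.C (1 / 2 : ℚ) * (1 - sqrtSeries) with hf
  set g := PowerSeries.map (Nat.castRingHom ℚ) PowerSeries.catalanSeries with hg
  have hhalf : (2 : ℚ⟦X⟧) * PowerSeries.C (1 / 2 : ℚ) = 1 := by
    rw [show (2 : ℚ⟦X⟧) = PowerSeries.C (2 : ℚ) from rfl, ← map_mul]; norm_num
  have h1 : f - f ^ 2 = PowerSeries.X := by
    have hs := sqrtSeries_sq
    have h4 : (4 : ℚ⟦X⟧) * (f - f ^ 2) = 4 * PowerSeries.X := by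
      have : 2 * f = 1 - sqrtSeries := by rw [hf, ← mul_assoc, hhalf, one_mul]
      linear_combination (1 + sqrtSeries - 2 * f) * this - hs
    have four_ne_zero : (4 : ℚ⟦X⟧) ≠ 0 := fun h => by
      have h' := congrArg PowerSeries.constantCoeff h
      rw [map_ofNat, map_zero] at h'
      norm_num at h'
    exact mul_left_cancel₀ four_ne_zero h4
  have h2 : g ^ 2 * PowerSeries.X + 1 = g := by
    have := congrArg (PowerSeries.map (Nat.castRingHom ℚ))
      PowerSeries.catalanSeries_sq_mul_X_add_one
    simpa using this
  -- `f` and `X * g` both solve `x - x² = X`, whose two solutions sum to 1; the constant term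
  -- excludes the other solution.
  have h3 : (f - PowerSeries.X * g) * (1 - f - PowerSeries.X * g) = 0 := by
    linear_combination h1 + PowerSeries.X * h2
  rcases mul_eq_zero.1 h3 with h | h
  · rw [map_mul, PowerSeries.map_X, ← hg]
    exact sub_eq_zero.1 h
  · exfalso
    have := congrArg PowerSeries.constantCoeff h
    simp [hf, constantCoeff_sqrtSeries] at this

theorem coe_oneSubUnit_zpow (p : ℕ) :
    ((oneSubUnit ^ (-((p : ℤ) + 1)) : ℚ⟦X⟧ˣ) : ℚ⟦X⟧) =
      PowerSeries.map (Nat.castRingHom ℚ) ((PowerSeries.mk 1) ^ (p + 1)) := by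
  have h1 : PowerSeries.map (Nat.castRingHom ℚ) (PowerSeries.mk 1) = PowerSeries.mk 1 := by
    ext n; simp
  have h2 : ((oneSubUnit⁻¹ : ℚ⟦X⟧ˣ) : ℚ⟦X⟧) = PowerSeries.mk 1 := by
    rw [Units.inv_eq_of_mul_eq_one_left]
    exact PowerSeries.mk_one_mul_one_sub_eq_one ℚ
  rw [map_pow, h1, ← h2, zpow_neg, ← inv_zpow, show ((p : ℤ) + 1) = ((p + 1 : ℕ) : ℤ) by simp,
    zpow_natCast, Units.val_pow_eq_pow_val]

theorem genC_eq_map (p r : ℕ) :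
    genC p r = PowerSeries.map (Nat.castRingHom ℚ) (natGen p r) := by
  rw [genC, natGen, coe_oneSubUnit_zpow, half_one_sub_sqrtSeries]
  simp only [map_mul, map_pow, map_add, PowerSeries.map_C, PowerSeries.map_X]
  rfl

theorem C_succ_eq_natCast (p q r : ℕ) :
    C p (q + 1) r = (PowerSeries.coeff q (natGen p r) : ℕ) := by
  rw [C, genC_eq_map]
  simp

/-- The factor `X ^ r` is what cuts the sum over `r` off at `q - 1`, in the indexing of `C`. -/
theorem coeff_natGen_of_lt (p q r : ℕ) (h : q < r) : PowerSeries.coeff q (natGen p r) = 0 := by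
  rw [natGen, mul_pow, mul_left_comm, PowerSeries.coeff_X_pow_mul', if_neg (by omega)]

/-! ### Absolutely convergent evaluation of power series -/

section EvalsTo

variable {𝕜 : Type*} [RCLike 𝕜]

/-- The power series `f` converges absolutely at `y`, with sum `v`. -/
def EvalsTo (f : ℕ⟦X⟧) (y v : 𝕜) : Prop :=
  Summable (fun n => ‖((PowerSeries.coeff n f : ℕ) : 𝕜) * y ^ n‖) ∧
    HasSum (fun n => ((PowerSeries.coeff n f : ℕ) : 𝕜) * y ^ n) v

theorem EvalsTo.mul {f g : ℕ⟦X⟧} {y v w : 𝕜} (hf : EvalsTo f y v) (hg : EvalsTo g y w) :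
    EvalsTo (f * g) y (v * w) := by
  have key : (fun n => ((PowerSeries.coeff n (f * g) : ℕ) : 𝕜) * y ^ n) = fun n =>
      ∑ kl ∈ Finset.HasAntidiagonal.antidiagonal n, (((PowerSeries.coeff kl.1 f : ℕ) : 𝕜) * y ^ kl.1) *
        (((PowerSeries.coeff kl.2 g : ℕ) : 𝕜) * y ^ kl.2) := by
    funext n
    rw [PowerSeries.coeff_mul, Nat.cast_sum, Finset.sum_mul]
    refine Finset.sum_congr rfl fun kl h => ?_
    rw [← Finset.HasAntidiagonal.mem_antidiagonal.1 h, pow_add]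
    push_cast
    ring
  have h1 := summable_norm_sum_mul_antidiagonal_of_summable_norm hf.1 hg.1
  have h2 := tsum_mul_tsum_eq_tsum_sum_antidiagonal_of_summable_norm hf.1 hg.1
  rw [hf.2.tsum_eq, hg.2.tsum_eq, ← key] at h2
  rw [show (fun n => ‖∑ kl ∈ Finset.HasAntidiagonal.antidiagonal n, (((PowerSeries.coeff kl.1 f : ℕ) : 𝕜) * y ^ kl.1) *
        (((PowerSeries.coeff kl.2 g : ℕ) : 𝕜) * y ^ kl.2)‖) =
      fun n => ‖((PowerSeries.coeff n (f * g) : ℕ) : 𝕜) * y ^ n‖ from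
    funext fun n => congrArg norm (congrFun key n).symm] at h1
  exact ⟨h1, h2 ▸ h1.of_norm.hasSum⟩

theorem EvalsTo.add {f g : ℕ⟦X⟧} {y v w : 𝕜} (hf : EvalsTo f y v) (hg : EvalsTo g y w) :
    EvalsTo (f + g) y (v + w) := by
  have key : (fun n => ((PowerSeries.coeff n (f + g) : ℕ) : 𝕜) * y ^ n) = fun n =>
      ((PowerSeries.coeff n f : ℕ) : 𝕜) * y ^ n + ((PowerSeries.coeff n g : ℕ) : 𝕜) * y ^ n := by
    funext n
    rw [map_add, Nat.cast_add, add_mul]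
  have h := hf.2.add hg.2
  rw [← key] at h
  refine ⟨Summable.of_nonneg_of_le (fun _ => norm_nonneg _) (fun n => ?_) (hf.1.add hg.1), h⟩
  rw [congrFun key n]
  exact norm_add_le _ _

theorem evalsTo_C (a : ℕ) (y : 𝕜) : EvalsTo (PowerSeries.C a) y (a : 𝕜) := by
  have h : ∀ n ≠ 0, ((PowerSeries.coeff n (PowerSeries.C a) : ℕ) : 𝕜) * y ^ n = 0 := fun n hn => by
    rw [PowerSeries.coeff_C, if_neg hn, Nat.cast_zero, zero_mul]
  refine ⟨(hasSum_single 0 fun n hn => by rw [h n hn, norm_zero]).summable, ?_⟩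
  simpa using hasSum_single 0 h

theorem evalsTo_X (y : 𝕜) : EvalsTo PowerSeries.X y y := by
  have h : ∀ n ≠ 1, ((PowerSeries.coeff n (PowerSeries.X : ℕ⟦X⟧) : ℕ) : 𝕜) * y ^ n = 0 := fun n hn => by
    simp [PowerSeries.coeff_X, hn]
  refine ⟨(hasSum_single 1 fun n hn => by rw [h n hn, norm_zero]).summable, ?_⟩
  simpa using hasSum_single 1 h

theorem EvalsTo.pow {f : ℕ⟦X⟧} {y v : 𝕜} (hf : EvalsTo f y v) (r : ℕ) :
    EvalsTo (f ^ r) y (v ^ r) := by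
  induction r with
  | zero => simpa using evalsTo_C 1 y
  | succ r ih => rw [pow_succ, pow_succ]; exact ih.mul hf

theorem evalsTo_mk_one {y : 𝕜} (hy : ‖y‖ < 1) : EvalsTo (PowerSeries.mk 1) y (1 - y)⁻¹ := by
  constructor
  · simpa using summable_geometric_of_lt_one (norm_nonneg y) hy
  · simpa using hasSum_geometric_of_norm_lt_one hy

theorem catalan_le_four_pow (n : ℕ) : catalan n ≤ 4 ^ n := by
  rw [catalan_eq_centralBinom_div]
  exact (Nat.div_le_self _ _).trans (Nat.centralBinom_le_four_pow n)

/-- The sum of the series `∑ catalan k y^{k+1}`, a root of `x (1 - x) = y`. -/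
def catVal (y : 𝕜) : 𝕜 := y * ∑' n, (catalan n : 𝕜) * y ^ n

theorem norm_catalan_term_le (y : 𝕜) (n : ℕ) : ‖(catalan n : 𝕜) * y ^ n‖ ≤ (4 * ‖y‖) ^ n := by
  rw [norm_mul, norm_pow, mul_pow, RCLike.norm_natCast]
  gcongr
  exact_mod_cast catalan_le_four_pow n

/-- Catalan numbers are at most `4 ^ n`, so `1/8` gives a geometric majorant of ratio at most `1/2`.
Its sum is the 2 in `norm_catVal_le`. -/
theorem evalsTo_catalanSeries {y : 𝕜} (hy : ‖y‖ ≤ 1 / 8) :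
    EvalsTo PowerSeries.catalanSeries y (∑' n, (catalan n : 𝕜) * y ^ n) := by
  have h : Summable fun n => ‖(catalan n : 𝕜) * y ^ n‖ :=
    Summable.of_nonneg_of_le (fun _ => norm_nonneg _) (norm_catalan_term_le y)
      (summable_geometric_of_lt_one (by positivity) (by linarith))
  constructor
  · simpa using h
  · simpa using h.of_norm.hasSum

theorem evalsTo_catVal {y : 𝕜} (hy : ‖y‖ ≤ 1 / 8) :
    EvalsTo (PowerSeries.X * PowerSeries.catalanSeries) y (catVal y) :=
  (evalsTo_X y).mul (evalsTo_catalanSeries hy)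

theorem catVal_mul_one_sub {y : 𝕜} (hy : ‖y‖ ≤ 1 / 8) : catVal y * (1 - catVal y) = y := by
  have h := evalsTo_catalanSeries hy
  have h2 := (((h.pow 2).mul (evalsTo_X y)).add (evalsTo_C 1 y))
  rw [map_one, PowerSeries.catalanSeries_sq_mul_X_add_one] at h2
  have h3 := h2.2.unique h.2
  unfold catVal
  push_cast at h3
  linear_combination (-y) * h3

theorem norm_catVal_le {y : 𝕜} (hy : ‖y‖ ≤ 1 / 8) : ‖catVal y‖ ≤ 2 * ‖y‖ := by
  have h : ‖∑' n, (catalan n : 𝕜) * y ^ n‖ ≤ (1 - 4 * ‖y‖)⁻¹ :=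
    tsum_of_norm_bounded (hasSum_geometric_of_lt_one (by positivity) (by linarith))
      (norm_catalan_term_le y)
  have h2 : (1 - 4 * ‖y‖)⁻¹ ≤ 2 := by
    rw [inv_le_comm₀ (by linarith) (by norm_num)]; linarith
  rw [catVal, norm_mul, mul_comm]
  exact mul_le_mul_of_nonneg_right (h.trans h2) (norm_nonneg _)

theorem catVal_nonneg {y : ℝ} (hy : 0 ≤ y) : 0 ≤ catVal y :=
  mul_nonneg hy (tsum_nonneg fun n => by positivity)

theorem evalsTo_natGen {y : 𝕜} (hy : ‖y‖ ≤ 1 / 8) (p r : ℕ) :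
    EvalsTo (natGen p r) y ((2 + y) * ((1 - y)⁻¹) ^ (p + 1) * catVal y ^ r) :=
  (((evalsTo_C 2 y).add (evalsTo_X y)).mul ((evalsTo_mk_one (by linarith)).pow _)).mul
    ((evalsTo_catVal hy).pow r)

end EvalsTo

/-! ### Partial fractions in S and bounds on the poles -/

/-- Partial fraction expansion of a product of linear fractional factors. -/
theorem prod_one_add_div_eq {ι : Type*} [DecidableEq ι] (s : Finset ι) (z w : ι → ℂ) (S : ℂ)
    (hz : Set.InjOn z s) (hS : ∀ i ∈ s, S ≠ z i) :
    ∏ i ∈ s, (1 + w i / (z i - S)) =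
      1 + ∑ i ∈ s, w i / (z i - S) * ∏ j ∈ s.erase i, (1 + w j / (z j - z i)) := by
  -- The product is a quotient of two nodal polynomials at `S`. Both are monic of degree `s.card`,
  -- so their difference has smaller degree and is recovered by Lagrange interpolation at the poles.
  set P := Lagrange.nodal s (fun i => z i + w i) - Lagrange.nodal s z with hP
  have hdeg : P.degree < s.card := by
    have := Polynomial.degree_sub_lt_left (p := Lagrange.nodal s (fun i => z i + w i))
      (q := Lagrange.nodal s z) (by rw [Lagrange.degree_nodal, Lagrange.degree_nodal])
      Lagrange.nodal_ne_zero
      (by rw [Lagrange.nodal_monic.leadingCoeff, Lagrange.nodal_monic.leadingCoeff])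
    rwa [Lagrange.degree_nodal] at this
  have h1 := congrArg (Polynomial.eval S) (Lagrange.eq_interpolate hz hdeg)
  rw [Lagrange.eval_interpolate_not_at_node _ hS, hP, Polynomial.eval_sub] at h1
  have h0 : Polynomial.eval S (Lagrange.nodal s z) ≠ 0 := Lagrange.eval_nodal_not_at_node hS
  have hl : ∏ i ∈ s, (1 + w i / (z i - S)) =
      Polynomial.eval S (Lagrange.nodal s (fun i => z i + w i)) /
        Polynomial.eval S (Lagrange.nodal s z) := by
    rw [Lagrange.eval_nodal, Lagrange.eval_nodal, ← Finset.prod_div_distrib]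
    refine Finset.prod_congr rfl fun i hi => ?_
    have : z i - S ≠ 0 := sub_ne_zero.2 (hS i hi).symm
    have : S - z i ≠ 0 := sub_ne_zero.2 (hS i hi)
    field_simp
    ring
  have hr : ∑ i ∈ s, w i / (z i - S) * ∏ j ∈ s.erase i, (1 + w j / (z j - z i)) =
      ∑ i ∈ s, Lagrange.nodalWeight s z i * (S - z i)⁻¹ * Polynomial.eval (z i) P := by
    refine Finset.sum_congr rfl fun i hi => ?_
    rw [hP, Polynomial.eval_sub, Lagrange.eval_nodal_at_node hi, sub_zero, Lagrange.eval_nodal,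
      ← Finset.mul_prod_erase s _ hi, Lagrange.nodalWeight]
    have e1 : ∏ j ∈ s.erase i, (1 + w j / (z j - z i)) =
        (∏ j ∈ s.erase i, (z i - z j)⁻¹) * ∏ j ∈ s.erase i, (z i - (z j + w j)) := by
      rw [← Finset.prod_mul_distrib]
      refine Finset.prod_congr rfl fun j hj => ?_
      have hne : z i ≠ z j := fun h => Finset.ne_of_mem_erase hj
        (hz hi (Finset.mem_of_mem_erase hj) h).symm
      have : z i - z j ≠ 0 := sub_ne_zero.2 hne
      have : z j - z i ≠ 0 := sub_ne_zero.2 hne.symm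
      field_simp
      ring
    rw [e1]
    have : z i - S ≠ 0 := sub_ne_zero.2 (hS i hi).symm
    have : S - z i ≠ 0 := sub_ne_zero.2 (hS i hi)
    field_simp
    ring
  rw [hl, hr, div_eq_iff h0]
  linear_combination h1

/-- The position, in the variable `S`, of the pole of the `i`-th factor. -/
def pole (T : ℂ) (i : ℕ) : ℂ := ((i : ℂ) + 1) ^ 2 - T / (i + 1)

/-- The residue of the `i`-th factor. -/
def poleWeight (T : ℂ) (i : ℕ) : ℂ := 2 * T / (i + 1)

theorem norm_natCast_add_one (i : ℕ) : ‖(i : ℂ) + 1‖ = (i : ℝ) + 1 := by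
  exact_mod_cast Complex.norm_natCast (i + 1)

theorem norm_div_natCast_add_one_le (T : ℂ) (i : ℕ) : ‖T / ((i : ℂ) + 1)‖ ≤ ‖T‖ := by
  rw [norm_div, norm_natCast_add_one]
  exact div_le_self (norm_nonneg _) (by linarith [(Nat.cast_nonneg i : (0 : ℝ) ≤ i)])

/-- The squares differ by `(j-i)(j+i+2)`, of norm at least `j+i+2`, while the `T`-terms move this by
at most `1/4`. The bound is uniform in `i`. -/
theorem le_norm_pole_sub_pole {T : ℂ} (hT : ‖T‖ ≤ 1 / 8) {i j : ℕ} (hij : j ≠ i) :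
    (j : ℝ) + 1 ≤ ‖pole T j - pole T i‖ := by
  have e : pole T j - pole T i = ((j : ℂ) - i) * (j + i + 2) - (T / (j + 1) - T / (i + 1)) := by
    unfold pole; ring
  have h1 : ‖T / ((j : ℂ) + 1) - T / (i + 1)‖ ≤ 1 / 4 :=
    (norm_sub_le _ _).trans (by
      linarith [norm_div_natCast_add_one_le T i, norm_div_natCast_add_one_le T j])
  have h2 : (1 : ℝ) ≤ ‖(j : ℂ) - i‖ := by
    have : (1 : ℤ) ≤ |(j : ℤ) - i| := Int.one_le_abs (by omega)
    have h : ‖(j : ℂ) - i‖ = ((|(j : ℤ) - i| : ℤ) : ℝ) := by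
      rw [Int.cast_abs, ← Complex.norm_intCast]; push_cast; rfl
    rw [h]; exact_mod_cast this
  have h3 : ‖(j : ℂ) + i + 2‖ = (j : ℝ) + i + 2 := by
    exact_mod_cast Complex.norm_natCast (j + i + 2)
  have h4 : (j : ℝ) + i + 2 ≤ ‖((j : ℂ) - i) * (j + i + 2)‖ := by
    rw [norm_mul, h3]
    nlinarith [(Nat.cast_nonneg i : (0 : ℝ) ≤ i), (Nat.cast_nonneg j : (0 : ℝ) ≤ j)]
  rw [e]
  linarith [norm_sub_norm_le (((j : ℂ) - i) * (j + i + 2)) (T / (j + 1) - T / (i + 1)),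
    (Nat.cast_nonneg i : (0 : ℝ) ≤ i)]

theorem le_norm_pole_sub {S T : ℂ} (hS : ‖S‖ ≤ 1 / 8) (hT : ‖T‖ ≤ 1 / 8) (i : ℕ) :
    ((i : ℝ) + 1) ^ 2 / 2 ≤ ‖pole T i - S‖ := by
  have e : pole T i - S = ((i : ℂ) + 1) ^ 2 - (T / (i + 1) + S) := by unfold pole; ring
  have h1 : ‖T / ((i : ℂ) + 1) + S‖ ≤ 1 / 4 :=
    (norm_add_le _ _).trans (by linarith [norm_div_natCast_add_one_le T i])
  have h2 : ‖((i : ℂ) + 1) ^ 2‖ = ((i : ℝ) + 1) ^ 2 := by rw [norm_pow, norm_natCast_add_one]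
  rw [e]
  have := norm_sub_norm_le (((i : ℂ) + 1) ^ 2) (T / (i + 1) + S)
  nlinarith [(Nat.cast_nonneg i : (0 : ℝ) ≤ i)]

theorem pole_sub_ne_zero {S T : ℂ} (hS : ‖S‖ ≤ 1 / 8) (hT : ‖T‖ ≤ 1 / 8) (i : ℕ) :
    pole T i - S ≠ 0 := fun h => by
  have := le_norm_pole_sub hS hT i
  rw [h, norm_zero] at this
  have : (0 : ℝ) < ((i : ℝ) + 1) ^ 2 / 2 := by positivity
  linarith

theorem pole_injective {T : ℂ} (hT : ‖T‖ ≤ 1 / 8) : Function.Injective (pole T) := by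
  intro j i h
  by_contra hne
  have := le_norm_pole_sub_pole hT hne
  rw [h, sub_self, norm_zero] at this
  linarith [(Nat.cast_nonneg j : (0 : ℝ) ≤ j)]

theorem summable_inv_sq_succ : Summable (fun n : ℕ => (((n : ℝ) + 1) ^ 2)⁻¹) := by
  have h2 : Summable (fun n : ℕ => (((n + 1 : ℕ) : ℝ) ^ 2)⁻¹) :=
    (summable_nat_add_iff 1).2 (Real.summable_nat_pow_inv.2 (by norm_num))
  simpa using h2

/-- The bound depends on neither `i` nor `N`, as dominated convergence over the poles requires. -/
theorem norm_prod_pole_le {T : ℂ} (hT : ‖T‖ ≤ 1 / 8) (i N : ℕ) :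
    ‖∏ j ∈ (Finset.range N).erase i, (1 + poleWeight T j / (pole T j - pole T i))‖ ≤
      Real.exp (∑' n : ℕ, (((n : ℝ) + 1) ^ 2)⁻¹) := by
  rw [norm_prod]
  calc _ ≤ ∏ j ∈ (Finset.range N).erase i, Real.exp ((((j : ℝ) + 1) ^ 2)⁻¹) := by
        refine Finset.prod_le_prod (fun _ _ => norm_nonneg _) fun j hj => ?_
        have h1 := le_norm_pole_sub_pole hT (Finset.ne_of_mem_erase hj)
        have hj0 : (0 : ℝ) < (j : ℝ) + 1 := by positivity
        have h2 : ‖poleWeight T j / (pole T j - pole T i)‖ ≤ (((j : ℝ) + 1) ^ 2)⁻¹ := by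
          rw [norm_div, poleWeight, norm_div, norm_mul, norm_natCast_add_one, Complex.norm_ofNat,
            div_div, ← one_div]
          gcongr
          · linarith
          · nlinarith
        calc _ ≤ ‖(1 : ℂ)‖ + _ := norm_add_le _ _
          _ ≤ (((j : ℝ) + 1) ^ 2)⁻¹ + 1 := by rw [norm_one]; linarith
          _ ≤ _ := Real.add_one_le_exp _
    _ = Real.exp (∑ j ∈ (Finset.range N).erase i, (((j : ℝ) + 1) ^ 2)⁻¹) := (Real.exp_sum _ _).symm
    _ ≤ _ := Real.exp_le_exp.2 (summable_inv_sq_succ.sum_le_tsum _ fun _ _ => by positivity)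

/-! ### Telescoping of the residue products -/

/-- The product `∏_{k=1}^{n} (c + k)` with `n = i + 1`. -/
def shiftProd (i : ℕ) (c : ℂ) : ℂ := ∏ k ∈ Finset.range (i + 1), (c + k + 1)

theorem shiftProd_add_one (i : ℕ) (c : ℂ) :
    shiftProd i (c + 1) * (c + 1) = shiftProd i c * (c + i + 2) := by
  have h1 : ∏ k ∈ Finset.range (i + 2), (c + (k : ℂ) + 1) = shiftProd i c * (c + i + 2) := by
    rw [Finset.prod_range_succ, shiftProd]; push_cast; ring
  have h2 : ∏ k ∈ Finset.range (i + 2), (c + (k : ℂ) + 1) = shiftProd i (c + 1) * (c + 1) := by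
    rw [Finset.prod_range_succ', shiftProd]
    congr 1
    · exact Finset.prod_congr rfl fun k _ => by push_cast; ring
    · simp
  rw [← h1, h2]

/-- The correction factor, tending to `1`, in the closed form of the finite residue products. -/
def residueRatio (i : ℕ) (a b : ℂ) (N : ℂ) : ℂ :=
  shiftProd i (N - (i + 1)) * shiftProd i N / (shiftProd i (N - a) * shiftProd i (N - b))

/-- The `m`-th factor of a residue product in factored form. -/
def residueFactor (n a b m : ℂ) : ℂ :=
  (m + n) * (m - a) * (m - b) / ((m - n) * (m + a) * (m + b))

theorem tendsto_natCast_add_div (a b : ℂ) :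
    Tendsto (fun N : ℕ => ((N : ℂ) + a) / (N + b)) atTop (𝓝 1) := by
  have h : Tendsto (fun N : ℕ => ((N : ℂ) + b)⁻¹) atTop (𝓝 0) := by
    refine tendsto_inv₀_cobounded.comp ?_
    rw [← tendsto_norm_atTop_iff_cobounded]
    refine tendsto_atTop_mono (f := fun N : ℕ => (N : ℝ) - ‖b‖) (fun N => ?_) ?_
    · have := norm_sub_norm_le (N : ℂ) (-b)
      rw [norm_neg, Complex.norm_natCast, sub_neg_eq_add] at this
      exact this
    · exact tendsto_atTop_add_const_right _ _ tendsto_natCast_atTop_atTop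
  have h2 : Tendsto (fun N : ℕ => 1 + (a - b) * ((N : ℂ) + b)⁻¹) atTop (𝓝 (1 + (a - b) * 0)) :=
    (h.const_mul _).const_add _
  rw [mul_zero, add_zero] at h2
  refine h2.congr' ?_
  have hne : ∀ᶠ N : ℕ in atTop, (N : ℂ) + b ≠ 0 := by
    filter_upwards [eventually_gt_atTop ⌈‖b‖⌉₊] with N hN h
    have : ‖b‖ < N := (Nat.le_ceil _).trans_lt (by exact_mod_cast hN)
    rw [show b = -(N : ℂ) by linear_combination h, norm_neg, Complex.norm_natCast] at this
    exact lt_irrefl _ this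
  filter_upwards [hne] with N hN
  field_simp
  ring

theorem tendsto_residueRatio (i : ℕ) (a b : ℂ) :
    Tendsto (fun N : ℕ => residueRatio i a b N) atTop (𝓝 1) := by
  have h : ∀ c d : ℂ, Tendsto (fun N : ℕ => shiftProd i ((N : ℂ) + c) / shiftProd i (N + d))
      atTop (𝓝 1) := fun c d => by
    have := tendsto_finsetProd (Finset.range (i + 1))
      (fun k _ => tendsto_natCast_add_div (c + k + 1) (d + k + 1))
    simp only [Finset.prod_const_one] at this
    refine this.congr fun N => ?_
    rw [shiftProd, shiftProd, ← Finset.prod_div_distrib]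
    exact Finset.prod_congr rfl fun k _ => by congr 1 <;> ring
  have h2 := (h (-(i + 1)) (-a)).mul (h 0 (-b))
  rw [mul_one] at h2
  refine h2.congr fun N => ?_
  rw [residueRatio, div_mul_div_comm, add_zero]
  simp only [sub_eq_add_neg]

/-- Under `m ↦ n - m` with `b = n - a`, `(m-b)/(m-n)` becomes `(m-a)/m`. -/
theorem prod_reflect_div (i : ℕ) (a b : ℂ) (hab : a + b = i + 1) :
    ∏ j ∈ Finset.range i, (((j : ℂ) + 1 - b) / (j + 1 - (i + 1))) =
      ∏ j ∈ Finset.range i, (((j : ℂ) + 1 - a) / (j + 1)) := by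
  rw [← Finset.prod_range_reflect]
  refine Finset.prod_congr rfl fun j hj => ?_
  have hj' := Finset.mem_range.1 hj
  have : ((i - 1 - j : ℕ) : ℂ) = i - 1 - j := by
    rw [Nat.cast_sub (by omega), Nat.cast_sub (by omega), Nat.cast_one]
  rw [this, ← neg_div_neg_eq]
  congr 1
  · linear_combination hab
  · ring

theorem shiftProd_succ (i : ℕ) (c : ℂ) :
    shiftProd i c = (∏ k ∈ Finset.range i, (c + k + 1)) * (c + (i + 1)) := by
  rw [shiftProd, Finset.prod_range_succ, add_assoc c]

/-- Start of the telescoping, with the factors `m < n`. Reflection supplies a second copy of `∏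
(m-a)/m`, whence the square; the prefactor comes from `(n+a)(n+b) = 2n² + ab`. -/
theorem prod_residueFactor_lt (i : ℕ) (a b : ℂ) (hab : a + b = i + 1)
    (ha : ∀ m : ℕ, (m : ℂ) + 1 + a ≠ 0) (hb : ∀ m : ℕ, (m : ℂ) + 1 + b ≠ 0) :
    ∏ j ∈ Finset.range i, residueFactor (i + 1) a b (j + 1) =
      (2 * (i + 1 : ℂ) ^ 2 + a * b) / (2 * (i + 1 : ℂ) ^ 2) *
        (∏ m ∈ Finset.range i, (1 - a / ((m : ℂ) + 1)) ^ 2) *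
          residueRatio i a b ((i : ℂ) + 1) := by
  have hi : ((i : ℂ) + 1) ≠ 0 := by exact_mod_cast Nat.succ_ne_zero i
  have hA := ha i
  have hB := hb i
  have e1 : 2 * (i + 1 : ℂ) ^ 2 + a * b = ((i : ℂ) + 1 + a) * (i + 1 + b) := by
    linear_combination (-(i : ℂ) - 1) * hab
  have e2 : residueRatio i a b ((i : ℂ) + 1) =
      (∏ k ∈ Finset.range i, (((k : ℂ) + 1) * (k + 1 + (i + 1)) / ((k + 1 + a) * (k + 1 + b)))) *
        (2 * (i + 1 : ℂ) ^ 2 / (((i : ℂ) + 1 + a) * (i + 1 + b))) := by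
    rw [residueRatio, sub_self, show (i : ℂ) + 1 - a = b by linear_combination -hab,
      show (i : ℂ) + 1 - b = a by linear_combination -hab, shiftProd_succ, shiftProd_succ,
      shiftProd_succ, shiftProd_succ, Finset.prod_div_distrib, Finset.prod_mul_distrib,
      Finset.prod_mul_distrib]
    have f1 : ∏ k ∈ Finset.range i, ((0 : ℂ) + k + 1) = ∏ k ∈ Finset.range i, ((k : ℂ) + 1) :=
      Finset.prod_congr rfl fun k _ => by ring
    have f2 : ∏ k ∈ Finset.range i, ((i : ℂ) + 1 + k + 1) =
        ∏ k ∈ Finset.range i, ((k : ℂ) + 1 + (i + 1)) :=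
      Finset.prod_congr rfl fun k _ => by ring
    have f3 : ∀ c : ℂ, ∏ k ∈ Finset.range i, (c + k + 1) = ∏ k ∈ Finset.range i, ((k : ℂ) + 1 + c) :=
      fun c => Finset.prod_congr rfl fun k _ => by ring
    rw [f1, f2, f3 a, f3 b, div_mul_div_comm]
    congr 1 <;> ring
  have e3 : ∏ j ∈ Finset.range i, residueFactor (i + 1) a b (j + 1) =
      (∏ j ∈ Finset.range i, (((j : ℂ) + 1 - b) / (j + 1 - (i + 1)))) *
        ∏ j ∈ Finset.range i,
          (((j : ℂ) + 1 + (i + 1)) * (j + 1 - a) / ((j + 1 + a) * (j + 1 + b))) := by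
    rw [← Finset.prod_mul_distrib]
    refine Finset.prod_congr rfl fun j _ => ?_
    rw [residueFactor, div_mul_div_comm]
    congr 1 <;> ring
  rw [e3, prod_reflect_div i a b hab, e2, e1]
  have e4 : ((i : ℂ) + 1 + a) * (i + 1 + b) / (2 * (i + 1 : ℂ) ^ 2) *
      (2 * (i + 1 : ℂ) ^ 2 / (((i : ℂ) + 1 + a) * (i + 1 + b))) = 1 := by
    field_simp
  have e5 : (∏ j ∈ Finset.range i, (((j : ℂ) + 1 - a) / (j + 1))) * (∏ j ∈ Finset.range i,
          (((j : ℂ) + 1 + (i + 1)) * (j + 1 - a) / ((j + 1 + a) * (j + 1 + b)))) =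
      (∏ m ∈ Finset.range i, (1 - a / ((m : ℂ) + 1)) ^ 2) *
      (∏ k ∈ Finset.range i,
        (((k : ℂ) + 1) * (k + 1 + (i + 1)) / ((k + 1 + a) * (k + 1 + b)))) := by
    rw [← Finset.prod_mul_distrib, ← Finset.prod_mul_distrib]
    refine Finset.prod_congr rfl fun j _ => ?_
    have := ha j
    have := hb j
    have hj : ((j : ℂ) + 1) ≠ 0 := by exact_mod_cast Nat.succ_ne_zero j
    field_simp
  rw [e5]
  linear_combination (-(∏ m ∈ Finset.range i, (1 - a / ((m : ℂ) + 1)) ^ 2) *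
      (∏ k ∈ Finset.range i,
        (((k : ℂ) + 1) * (k + 1 + (i + 1)) / ((k + 1 + a) * (k + 1 + b))))) * e4

/-- Raising `c` by 1 multiplies `shiftProd i c` by `(c+n+1)/(c+1)`. Because `a + b = n`, the end `N
- a + n + 1` equals `N + 1 + b`, so the four quotients assemble into one residue factor. -/
theorem residueRatio_add_one (i : ℕ) (a b N : ℂ) (hab : a + b = i + 1) (h0 : N + 1 ≠ 0)
    (h1 : N - (i + 1) + 1 ≠ 0) (ha : N - a + 1 ≠ 0) (hb : N - b + 1 ≠ 0) :
    residueRatio i a b (N + 1) = residueRatio i a b N * residueFactor (i + 1) a b (N + 1) := by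
  have h : ∀ c : ℂ, c + 1 ≠ 0 → shiftProd i (c + 1) = shiftProd i c * (c + i + 2) / (c + 1) :=
    fun c hc => by rw [← shiftProd_add_one, mul_div_cancel_right₀ _ hc]
  rw [residueRatio, show N + 1 - ((i : ℂ) + 1) = N - (i + 1) + 1 by ring, show N + 1 - a = N - a + 1 by ring,
    show N + 1 - b = N - b + 1 by ring, h _ h0, h _ h1, h _ ha, h _ hb, residueRatio, residueFactor,
    show N - a + i + 2 = N + 1 + b by linear_combination -hab,
    show N - b + i + 2 = N + 1 + a by linear_combination -hab,
    show N + 1 - ((i : ℂ) + 1) = N - (i + 1) + 1 by ring, show N + 1 - a = N - a + 1 by ring,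
    show N + 1 - b = N - b + 1 by ring, show N - ((i : ℂ) + 1) + i + 2 = N + 1 by ring]
  field_simp
  ring

theorem prod_residueFactor (i M : ℕ) (a b : ℂ) (hab : a + b = i + 1)
    (ha : ∀ m : ℕ, (m : ℂ) + 1 + a ≠ 0) (ha' : ∀ m : ℕ, (m : ℂ) + 1 - a ≠ 0) :
    ∏ j ∈ (Finset.range (i + 1 + M)).erase i, residueFactor (i + 1) a b (j + 1) =
      (2 * (i + 1 : ℂ) ^ 2 + a * b) / (2 * (i + 1 : ℂ) ^ 2) *
        (∏ m ∈ Finset.range i, (1 - a / ((m : ℂ) + 1)) ^ 2) *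
          residueRatio i a b ((i + 1 + M : ℕ) : ℂ) := by
  have hb : ∀ m : ℕ, (m : ℂ) + 1 + b ≠ 0 := fun m => by
    have := ha' (m + i + 1)
    push_cast at this
    rw [show b = i + 1 - a by linear_combination hab]
    convert this using 1
    ring
  induction M with
  | zero =>
    rw [show (Finset.range (i + 1 + 0)).erase i = Finset.range i by
      ext j; simp; omega]
    have := prod_residueFactor_lt i a b hab ha hb
    simpa using this
  | succ M ih =>
    have e : (Finset.range (i + 1 + (M + 1))).erase i =
        insert (i + 1 + M) ((Finset.range (i + 1 + M)).erase i) := by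
      ext j; simp; omega
    rw [e, Finset.prod_insert (by simp), ih, show ((i + 1 + (M + 1) : ℕ) : ℂ) =
      ((i + 1 + M : ℕ) : ℂ) + 1 by push_cast; ring, residueRatio_add_one i a b _ hab]
    · ring
    · exact_mod_cast Nat.succ_ne_zero (i + 1 + M)
    · push_cast
      convert (Nat.cast_ne_zero (R := ℂ)).2 (Nat.succ_ne_zero M) using 1
      push_cast; ring
    · convert ha' (i + 1 + M) using 1
      ring
    · convert ha M using 1
      push_cast
      linear_combination -hab

/-- The parameter `T / n³` with `n = i + 1`. -/
def yVal (T : ℂ) (i : ℕ) : ℂ := T / ((i : ℂ) + 1) ^ 3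

theorem norm_yVal (T : ℂ) (i : ℕ) : ‖yVal T i‖ = ‖T‖ / ((i : ℝ) + 1) ^ 3 := by
  rw [yVal, norm_div, norm_pow, norm_natCast_add_one]

theorem norm_yVal_le {T : ℂ} (hT : ‖T‖ ≤ 1 / 8) (i : ℕ) : ‖yVal T i‖ ≤ 1 / 8 := by
  rw [norm_yVal]
  refine (div_le_self (norm_nonneg _) (one_le_pow₀ ?_)).trans hT
  linarith [(Nat.cast_nonneg i : (0 : ℝ) ≤ i)]

theorem norm_mul_catVal_le {T : ℂ} (hT : ‖T‖ ≤ 1 / 8) (i : ℕ) :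
    ‖((i : ℂ) + 1) * catVal (yVal T i)‖ ≤ 1 / 4 := by
  rw [norm_mul, norm_natCast_add_one]
  have h1 := norm_catVal_le (norm_yVal_le hT i)
  rw [norm_yVal] at h1
  have hi : (1 : ℝ) ≤ (i : ℝ) + 1 := by linarith [(Nat.cast_nonneg i : (0 : ℝ) ≤ i)]
  calc _ ≤ ((i : ℝ) + 1) * (2 * (‖T‖ / ((i : ℝ) + 1) ^ 3)) := by gcongr
    _ = 2 * (‖T‖ / ((i : ℝ) + 1) ^ 2) := by field_simp
    _ ≤ 2 * ‖T‖ := by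
      gcongr
      exact div_le_self (norm_nonneg _) (one_le_pow₀ hi)
    _ ≤ _ := by linarith

/-- At the pole the denominator cubic in `m` has roots `n, -a, -b`; the numerator is minus that
cubic at `-m`. -/
theorem one_add_poleWeight_div_eq (T n m a b : ℂ) (hn : n ≠ 0) (hm : m ≠ 0) (hab : a + b = n)
    (hT : n * a * b = T) (hd : m ^ 2 - T / m - (n ^ 2 - T / n) ≠ 0) :
    1 + 2 * T / m / (m ^ 2 - T / m - (n ^ 2 - T / n)) = residueFactor n a b m := by
  subst hab hT
  have e1 : m * (m ^ 2 - (a + b) * a * b / m - ((a + b) ^ 2 - (a + b) * a * b / (a + b))) =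
      (m - (a + b)) * (m + a) * (m + b) := by
    field_simp
    ring
  have hd' : (m - (a + b)) * (m + a) * (m + b) ≠ 0 := e1 ▸ mul_ne_zero hm hd
  rw [residueFactor, div_div, e1, eq_div_iff hd', add_mul, one_mul, div_mul_cancel₀ _ hd']
  ring

theorem tendsto_prod_pole {T : ℂ} (hT : ‖T‖ ≤ 1 / 8) (i : ℕ) :
    Tendsto (fun N : ℕ => ∏ j ∈ (Finset.range N).erase i,
      (1 + poleWeight T j / (pole T j - pole T i))) atTop
      (𝓝 ((2 + yVal T i) / 2 * ∏ m ∈ Finset.range i,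
        (1 - ((i : ℂ) + 1) * catVal (yVal T i) / ((m : ℂ) + 1)) ^ 2)) := by
  set y := yVal T i with hy
  set x := catVal y with hx
  have hxy : x * (1 - x) = y := catVal_mul_one_sub (norm_yVal_le hT i)
  -- The choice solving `a + b = n` and `nab = T`, by `x(1-x) = T/n³`.
  set a := ((i : ℂ) + 1) * x with ha
  set b := ((i : ℂ) + 1) * (1 - x) with hb
  have hi : ((i : ℂ) + 1) ≠ 0 := by exact_mod_cast Nat.succ_ne_zero i
  have hab : a + b = i + 1 := by rw [ha, hb]; ring
  have hyT : ((i : ℂ) + 1) ^ 3 * y = T := by rw [hy, yVal]; field_simp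
  have habT : ((i : ℂ) + 1) * a * b = T := by
    rw [ha, hb, ← hyT, ← hxy]; ring
  have hna : ‖a‖ ≤ 1 / 4 := norm_mul_catVal_le hT i
  have hne : ∀ (m : ℕ) (c : ℂ), ‖c‖ ≤ 1 / 4 → (m : ℂ) + 1 + c ≠ 0 := fun m c hc h => by
    have : c = -((m : ℂ) + 1) := by linear_combination h
    rw [this, norm_neg, norm_natCast_add_one] at hc
    linarith [(Nat.cast_nonneg m : (0 : ℝ) ≤ m)]
  have hfac : ∀ N : ℕ, ∏ j ∈ (Finset.range N).erase i,
      (1 + poleWeight T j / (pole T j - pole T i)) =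
      ∏ j ∈ (Finset.range N).erase i, residueFactor (i + 1) a b (j + 1) := fun N => by
    refine Finset.prod_congr rfl fun j hj => ?_
    have hj0 : ((j : ℂ) + 1) ≠ 0 := by exact_mod_cast Nat.succ_ne_zero j
    refine one_add_poleWeight_div_eq T (i + 1) (j + 1) a b hi hj0 hab habT ?_
    exact sub_ne_zero.2 fun h => Finset.ne_of_mem_erase hj (pole_injective hT h)
  have hlim : Tendsto (fun N : ℕ => (2 + y) / 2 * (∏ m ∈ Finset.range i,
      (1 - a / ((m : ℂ) + 1)) ^ 2) * residueRatio i a b (N : ℂ)) atTop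
      (𝓝 ((2 + y) / 2 * ∏ m ∈ Finset.range i, (1 - a / ((m : ℂ) + 1)) ^ 2)) := by
    simpa using (tendsto_residueRatio i a b).const_mul
      ((2 + y) / 2 * ∏ m ∈ Finset.range i, (1 - a / ((m : ℂ) + 1)) ^ 2)
  refine hlim.congr' ?_
  filter_upwards [eventually_ge_atTop (i + 1)] with N hN
  obtain ⟨M, rfl⟩ := Nat.exists_eq_add_of_le hN
  rw [hfac, prod_residueFactor i M a b hab (fun m => hne m a hna)
    (fun m => by rw [sub_eq_add_neg]; exact hne m (-a) (by rwa [norm_neg]))]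
  congr 2
  rw [← hxy, ha, hb]
  field_simp

/-! ### Partial fraction expansion of the Virasoro function -/

/-- The `n`-th term, `n = i + 1`, of the partial fraction expansion of the Virasoro function. -/
def mainTerm (S T : ℂ) (i : ℕ) : ℂ :=
  yVal T i * (2 + yVal T i) / (1 - yVal T i - S / ((i : ℂ) + 1) ^ 2) *
    ∏ m ∈ Finset.range i, (1 - ((i : ℂ) + 1) * catVal (yVal T i) / ((m : ℂ) + 1)) ^ 2

theorem tendsto_prod_one_add {S T : ℂ} (hS : ‖S‖ ≤ 1 / 8) (hT : ‖T‖ ≤ 1 / 8) :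
    Tendsto (fun N : ℕ => ∏ j ∈ Finset.range N, (1 + poleWeight T j / (pole T j - S))) atTop
      (𝓝 (1 + ∑' i, mainTerm S T i)) := by
  have h1 : ∀ N : ℕ, ∏ j ∈ Finset.range N, (1 + poleWeight T j / (pole T j - S)) =
      1 + ∑' i, if i ∈ Finset.range N then poleWeight T i / (pole T i - S) *
        ∏ j ∈ (Finset.range N).erase i, (1 + poleWeight T j / (pole T j - pole T i)) else 0 := by
    intro N
    rw [prod_one_add_div_eq _ _ _ _ (pole_injective hT).injOn
      (fun i _ => (sub_ne_zero.1 (pole_sub_ne_zero hS hT i)).symm)]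
    rw [tsum_eq_sum (s := Finset.range N) (fun i hi => if_neg hi)]
    congr 1
    exact Finset.sum_congr rfl fun i hi => (if_pos hi).symm
  simp only [h1]
  refine Tendsto.const_add _ ?_
  set K := Real.exp (∑' n : ℕ, (((n : ℝ) + 1) ^ 2)⁻¹) with hK
  refine tendsto_tsum_of_dominated_convergence
    (bound := fun i : ℕ => K * (((i : ℝ) + 1) ^ 2)⁻¹) (summable_inv_sq_succ.mul_left K) ?_ ?_
  · intro i
    have e : mainTerm S T i = poleWeight T i / (pole T i - S) * ((2 + yVal T i) / 2 *
        ∏ m ∈ Finset.range i,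
          (1 - ((i : ℂ) + 1) * catVal (yVal T i) / ((m : ℂ) + 1)) ^ 2) := by
      have hi : ((i : ℂ) + 1) ≠ 0 := by exact_mod_cast Nat.succ_ne_zero i
      have hp := pole_sub_ne_zero hS hT i
      have hp2 : pole T i - S = ((i : ℂ) + 1) ^ 2 * (1 - yVal T i - S / ((i : ℂ) + 1) ^ 2) := by
        rw [pole, yVal]; field_simp
      have hw : poleWeight T i = 2 * ((i : ℂ) + 1) ^ 2 * yVal T i := by
        rw [poleWeight, yVal]; field_simp
      have hd : 1 - yVal T i - S / ((i : ℂ) + 1) ^ 2 ≠ 0 := fun h => hp (by rw [hp2, h, mul_zero])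
      rw [mainTerm, hp2, hw, ← mul_assoc]
      congr 1
      generalize 1 - yVal T i - S / ((i : ℂ) + 1) ^ 2 = d at hd
      field_simp
    rw [e]
    refine ((tendsto_prod_pole hT i).const_mul _).congr' ?_
    filter_upwards [eventually_gt_atTop i] with N hN
    rw [if_pos (Finset.mem_range.2 hN)]
  · refine Eventually.of_forall fun N i => ?_
    split_ifs
    · rw [norm_mul, mul_comm]
      refine mul_le_mul (norm_prod_pole_le hT i N) ?_ (norm_nonneg _) (Real.exp_pos _).le
      have hi : (1 : ℝ) ≤ (i : ℝ) + 1 := by linarith [(Nat.cast_nonneg i : (0 : ℝ) ≤ i)]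
      have hp := le_norm_pole_sub hS hT i
      rw [norm_div, div_le_iff₀ (lt_of_lt_of_le (by positivity) hp)]
      have hw : ‖poleWeight T i‖ ≤ 1 / 2 := by
        refine (norm_div_natCast_add_one_le (2 * T) i).trans ?_
        rw [norm_mul, Complex.norm_ofNat]; linarith
      calc _ ≤ (1 / 2 : ℝ) := hw
        _ = (((i : ℝ) + 1) ^ 2)⁻¹ * (((i : ℝ) + 1) ^ 2 / 2) := by field_simp
        _ ≤ _ := by gcongr
    · rw [norm_zero]; positivity

theorem tendsto_prod_Vcl {s t u : ℂ} (h : s + t + u = 0) (hs : ‖s‖ < 1) (ht : ‖t‖ < 1)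
    (hu : ‖u‖ < 1) :
    Tendsto (fun N : ℕ => ∏ j ∈ Finset.range N, (1 + poleWeight (-(s * t * u)) j /
      (pole (-(s * t * u)) j - (s ^ 2 + s * t + t ^ 2)))) atTop (𝓝 (Vcl s t u)) := by
  have hne : ∀ c : ℂ, ‖c‖ < 1 → ∀ j : ℕ, 1 + c + j ≠ 0 := fun c hc j h0 => by
    have : c = -((j : ℂ) + 1) := by linear_combination h0
    rw [this, norm_neg, norm_natCast_add_one] at hc
    linarith [(Nat.cast_nonneg j : (0 : ℝ) ≤ j)]
  have hG : ∀ c : ℂ, ‖c‖ < 1 → Complex.Gamma (1 - c) ≠ 0 := fun c hc =>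
    Complex.Gamma_ne_zero fun m h0 => hne (-c) (by rwa [norm_neg]) m (by linear_combination h0)
  have hl : Tendsto (fun N : ℕ =>
      (Complex.GammaSeq (1 + s) N * Complex.GammaSeq (1 + t) N * Complex.GammaSeq (1 + u) N) /
      (Complex.GammaSeq (1 - s) N * Complex.GammaSeq (1 - t) N * Complex.GammaSeq (1 - u) N)) atTop
      (𝓝 (Vcl s t u)) := by
    have g := Complex.GammaSeq_tendsto_Gamma
    exact (((g _).mul (g _)).mul (g _)).div (((g _).mul (g _)).mul (g _))
      (mul_ne_zero (mul_ne_zero (hG s hs) (hG t ht)) (hG u hu))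
  -- `GammaSeq _ N` has `N + 1` linear factors. The powers of `N` cancel because `s + t + u = 0`
  -- makes both exponent sums equal to 3.
  rw [← tendsto_add_atTop_iff_nat 1]
  refine hl.congr' ?_
  filter_upwards [eventually_gt_atTop 0] with N hN
  have hN0 : (N : ℂ) ≠ 0 := by exact_mod_cast hN.ne'
  have hfac : (N.factorial : ℂ) ≠ 0 := by exact_mod_cast N.factorial_ne_zero
  have hp : ∀ c : ℂ, ‖c‖ < 1 → ∏ j ∈ Finset.range (N + 1), (1 + c + (j : ℂ)) ≠ 0 := fun c hc =>
    Finset.prod_ne_zero_iff.2 fun j _ => hne c hc j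
  have hp' : ∀ c : ℂ, ‖c‖ < 1 → ∏ j ∈ Finset.range (N + 1), (1 - c + (j : ℂ)) ≠ 0 := fun c hc => by
    have := hp (-c) (by rwa [norm_neg]); simpa [sub_eq_add_neg] using this
  have e1 : (N : ℂ) ^ (1 + s) * (N : ℂ) ^ (1 + t) * (N : ℂ) ^ (1 + u) = (N : ℂ) ^ (3 : ℂ) := by
    rw [← Complex.cpow_add _ _ hN0, ← Complex.cpow_add _ _ hN0]
    congr 1; linear_combination h
  have e2 : (N : ℂ) ^ (1 - s) * (N : ℂ) ^ (1 - t) * (N : ℂ) ^ (1 - u) = (N : ℂ) ^ (3 : ℂ) := by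
    rw [← Complex.cpow_add _ _ hN0, ← Complex.cpow_add _ _ hN0]
    congr 1; linear_combination -h
  have e0 : (N : ℂ) ^ (3 : ℂ) ≠ 0 := by simp [hN0]
  have e3 : (Complex.GammaSeq (1 + s) N * Complex.GammaSeq (1 + t) N * Complex.GammaSeq (1 + u) N) /
      (Complex.GammaSeq (1 - s) N * Complex.GammaSeq (1 - t) N * Complex.GammaSeq (1 - u) N) =
      (∏ j ∈ Finset.range (N + 1), (1 - s + (j : ℂ)) * (1 - t + j) * (1 - u + j)) /
      ∏ j ∈ Finset.range (N + 1), (1 + s + (j : ℂ)) * (1 + t + j) * (1 + u + j) := by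
    simp only [Finset.prod_mul_distrib]
    unfold Complex.GammaSeq
    have := hp s hs
    have := hp t ht
    have := hp u hu
    have := hp' s hs
    have := hp' t ht
    have := hp' u hu
    have a1 : ∀ A B C D E F f : ℂ, A * f / D * (B * f / E) * (C * f / F) =
      (A * B * C) * f ^ 3 / (D * E * F) := fun A B C D E F f => by
        rw [div_mul_div_comm, div_mul_div_comm]; ring
    rw [a1, a1, e1, e2]
    field_simp
  rw [e3, ← Finset.prod_div_distrib]
  refine Finset.prod_congr rfl fun j _ => ?_
  have hj : ((j : ℂ) + 1) ≠ 0 := by exact_mod_cast Nat.succ_ne_zero j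
  have d := mul_ne_zero (mul_ne_zero (hne s hs j) (hne t ht j)) (hne u hu j)
  obtain rfl : u = -s - t := by linear_combination h
  have e4 : ((j : ℂ) + 1) * (pole (-(s * t * (-s - t))) j - (s ^ 2 + s * t + t ^ 2)) =
      (1 + s + (j : ℂ)) * (1 + t + j) * (1 + (-s - t) + j) := by
    rw [pole]; field_simp; ring
  rw [poleWeight, div_div, e4, div_eq_iff d, add_mul (1 : ℂ), one_mul, div_mul_cancel₀ _ d]
  ring

/-! ### The fourfold expansion and its absolute convergence -/

section Double

variable {𝕜 : Type*} [RCLike 𝕜]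

theorem hasSum_geometric_natGen {σ y : 𝕜} (hσ : ‖σ‖ ≤ 1 / 8) (hy : ‖y‖ ≤ 1 / 8) (r : ℕ) :
    HasSum (fun p : ℕ => σ ^ p * ((2 + y) * ((1 - y)⁻¹) ^ (p + 1) * catVal y ^ r))
      ((2 + y) / (1 - y - σ) * catVal y ^ r) := by
  have hy1 : 7 / 8 ≤ ‖1 - y‖ := by
    have := norm_sub_norm_le (1 : 𝕜) y
    rw [norm_one] at this; linarith
  have h1 : 1 - y ≠ 0 := norm_pos_iff.1 (by linarith)
  have h2 : 1 - y - σ ≠ 0 := norm_pos_iff.1 (by linarith [norm_sub_norm_le (1 - y) σ])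
  have hlt : ‖σ * (1 - y)⁻¹‖ < 1 := by
    rw [norm_mul, norm_inv, ← div_eq_mul_inv, div_lt_one (by linarith)]; linarith
  have h := (hasSum_geometric_of_norm_lt_one hlt).mul_left
    ((2 + y) * (1 - y)⁻¹ * catVal y ^ r)
  have e : (2 + y) * (1 - y)⁻¹ * catVal y ^ r * (1 - σ * (1 - y)⁻¹)⁻¹ =
      (2 + y) / (1 - y - σ) * catVal y ^ r := by
    have : 1 - σ * (1 - y)⁻¹ = (1 - y - σ) * (1 - y)⁻¹ := by field_simp
    rw [this, mul_inv, inv_inv]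
    field_simp
  rw [e] at h
  refine h.congr_fun fun p => ?_
  rw [mul_pow, pow_succ]
  ring

/-- The coefficients are natural numbers, so the series of norms is the same series at `‖σ‖`, `‖y‖`
and has a known sum. -/
theorem summable_norm_natGen {σ y : 𝕜} (hσ : ‖σ‖ ≤ 1 / 8) (hy : ‖y‖ ≤ 1 / 8) (r : ℕ) :
    Summable (fun x : ℕ × ℕ =>
      ‖σ ^ x.1 * (((PowerSeries.coeff x.2 (natGen x.1 r) : ℕ) : 𝕜) * y ^ x.2)‖) := by
  have hyn : ‖(‖y‖ : ℝ)‖ ≤ 1 / 8 := by rwa [norm_norm]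
  have hσn : ‖(‖σ‖ : ℝ)‖ ≤ 1 / 8 := by rwa [norm_norm]
  have hin : ∀ p : ℕ, HasSum (fun q : ℕ =>
      ‖σ ^ p * (((PowerSeries.coeff q (natGen p r) : ℕ) : 𝕜) * y ^ q)‖)
      (‖σ‖ ^ p * ((2 + ‖y‖) * ((1 - ‖y‖)⁻¹) ^ (p + 1) * catVal ‖y‖ ^ r)) := fun p => by
    have := (evalsTo_natGen hyn p r).2.mul_left (‖σ‖ ^ p)
    simpa only [norm_mul, norm_pow, RCLike.norm_natCast] using this
  refine (summable_prod_of_nonneg fun _ => norm_nonneg _).2 ⟨fun p => (hin p).summable, ?_⟩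
  simp only [(hin _).tsum_eq]
  exact (hasSum_geometric_natGen hσn hyn r).summable

theorem hasSum_natGen {σ y : 𝕜} (hσ : ‖σ‖ ≤ 1 / 8) (hy : ‖y‖ ≤ 1 / 8) (r : ℕ) :
    HasSum (fun x : ℕ × ℕ =>
      σ ^ x.1 * (((PowerSeries.coeff x.2 (natGen x.1 r) : ℕ) : 𝕜) * y ^ x.2))
      ((2 + y) / (1 - y - σ) * catVal y ^ r) := by
  have h := (summable_norm_natGen hσ hy r).of_norm.hasSum
  have h2 := h.prod_fiberwise fun p => (evalsTo_natGen hy p r).2.mul_left (σ ^ p)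
  rwa [h2.unique (hasSum_geometric_natGen hσ hy r)] at h

theorem hasSum_sqProd (i : ℕ) (c : 𝕜) :
    HasSum (fun r : ℕ => c ^ r * (((sqProd i).coeff r : ℝ) : 𝕜))
      (∏ m ∈ Finset.range i, (1 + c / ((m : 𝕜) + 1)) ^ 2) := by
  have e : (∏ m ∈ Finset.range i, (1 + c / ((m : 𝕜) + 1)) ^ 2) =
      ((sqProd i).map (algebraMap ℝ 𝕜)).eval c := by
    rw [sqProd, Polynomial.map_prod, Polynomial.eval_prod]
    refine Finset.prod_congr rfl fun m _ => ?_
    simp [div_eq_inv_mul]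
  rw [e, Polynomial.eval_eq_sum_range]
  have h : HasSum (fun r : ℕ => c ^ r * (((sqProd i).coeff r : ℝ) : 𝕜))
      (∑ r ∈ Finset.range (((sqProd i).map (algebraMap ℝ 𝕜)).natDegree + 1),
        c ^ r * (((sqProd i).coeff r : ℝ) : 𝕜)) :=
    hasSum_sum_of_ne_finset_zero fun r hr => by
      have : (sqProd i).coeff r = 0 := by
        refine Polynomial.coeff_eq_zero_of_natDegree_lt ?_
        rw [Polynomial.natDegree_map] at hr
        simpa using hr
      simp [this]
  convert h using 1
  exact Finset.sum_congr rfl fun r _ => by rw [Polynomial.coeff_map, mul_comm]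

end Double

/-- The terms of the fourfold expansion of the Virasoro function, indexed by `((i, r), (p, q))`. -/
def expTerm (S T : ℂ) (x : (ℕ × ℕ) × (ℕ × ℕ)) : ℂ :=
  yVal T x.1.1 * ((-((x.1.1 : ℂ) + 1)) ^ x.1.2 * (((sqProd x.1.1).coeff x.1.2 : ℝ) : ℂ)) *
    ((S / ((x.1.1 : ℂ) + 1) ^ 2) ^ x.2.1 *
      (((PowerSeries.coeff x.2.2 (natGen x.2.1 x.1.2) : ℕ) : ℂ) * yVal T x.1.1 ^ x.2.2))

theorem norm_div_sq_le {S : ℂ} (hS : ‖S‖ ≤ 1 / 8) (i : ℕ) : ‖S / ((i : ℂ) + 1) ^ 2‖ ≤ 1 / 8 := by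
  rw [norm_div, norm_pow, norm_natCast_add_one]
  refine (div_le_self (norm_nonneg _) (one_le_pow₀ ?_)).trans hS
  linarith [(Nat.cast_nonneg i : (0 : ℝ) ≤ i)]

/-- Each factor is at most `exp(1/(4n))²` with `n = i + 1`, and there are fewer than `n` of them. -/
theorem prod_one_add_sq_le {T : ℂ} (hT : ‖T‖ ≤ 1 / 8) (i : ℕ) :
    ∏ m ∈ Finset.range i, (1 + ((i : ℝ) + 1) * catVal ‖yVal T i‖ / ((m : ℝ) + 1)) ^ 2 ≤
      Real.exp 1 := by
  have hc0 : 0 ≤ catVal ‖yVal T i‖ := catVal_nonneg (norm_nonneg _)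
  have hi : (1 : ℝ) ≤ (i : ℝ) + 1 := by linarith [(Nat.cast_nonneg i : (0 : ℝ) ≤ i)]
  have hc : catVal ‖yVal T i‖ ≤ 1 / 4 / ((i : ℝ) + 1) ^ 3 := by
    have := norm_catVal_le (y := ‖yVal T i‖) (by rw [norm_norm]; exact norm_yVal_le hT i)
    rw [norm_norm, Real.norm_of_nonneg hc0] at this
    refine this.trans ?_
    rw [norm_yVal, ← mul_div_assoc]
    gcongr
    linarith
  have hq : ((i : ℝ) + 1) * catVal ‖yVal T i‖ ≤ 1 / 4 / ((i : ℝ) + 1) := by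
    calc _ ≤ ((i : ℝ) + 1) * (1 / 4 / ((i : ℝ) + 1) ^ 3) := by gcongr
      _ = 1 / 4 / ((i : ℝ) + 1) ^ 2 := by field_simp
      _ ≤ _ := by
        gcongr
        nlinarith
  calc _ ≤ ∏ m ∈ Finset.range i, Real.exp (1 / 2 / ((i : ℝ) + 1)) := by
        refine Finset.prod_le_prod (fun m _ => by positivity) fun m _ => ?_
        have hm : ((i : ℝ) + 1) * catVal ‖yVal T i‖ / ((m : ℝ) + 1) ≤ 1 / 4 / ((i : ℝ) + 1) :=
          (div_le_self (by positivity) (by linarith [(Nat.cast_nonneg m : (0 : ℝ) ≤ m)])).trans hq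
        calc _ ≤ (Real.exp (1 / 4 / ((i : ℝ) + 1))) ^ 2 := by
              have := Real.add_one_le_exp (1 / 4 / ((i : ℝ) + 1))
              refine pow_le_pow_left₀ (by positivity) (by linarith) 2
          _ = _ := by rw [← Real.exp_nat_mul]; congr 1; push_cast; ring
    _ = Real.exp (i * (1 / 2 / ((i : ℝ) + 1))) := by
        rw [Finset.prod_const, Finset.card_range, Real.exp_nat_mul]
    _ ≤ _ := by
        rw [Real.exp_le_exp, ← mul_div_assoc, div_le_one (by positivity)]
        linarith [(Nat.cast_nonneg i : (0 : ℝ) ≤ i)]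

/-- Taking norms only replaces `S`, `T` by their norms and removes the sign in `r`. The sums over
`(p, q)` and `r` then have closed forms, leaving a series in `i` bounded by a multiple of `∑ 1/n²`.
-/
theorem summable_expTerm {S T : ℂ} (hS : ‖S‖ ≤ 1 / 8) (hT : ‖T‖ ≤ 1 / 8) :
    Summable (expTerm S T) := by
  refine Summable.of_norm ((summable_prod_of_nonneg fun _ => norm_nonneg _).2 ⟨fun ir => ?_, ?_⟩)
  · simp only [expTerm, norm_mul (yVal T _ * _)]
    exact (summable_norm_natGen (norm_div_sq_le hS _) (norm_yVal_le hT _) _).mul_left _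
  have hin : ∀ ir : ℕ × ℕ, ∑' pq, ‖expTerm S T (ir, pq)‖ =
      ‖yVal T ir.1‖ * ((2 + ‖yVal T ir.1‖) /
        (1 - ‖yVal T ir.1‖ - ‖S / ((ir.1 : ℂ) + 1) ^ 2‖)) *
        ((((ir.1 : ℝ) + 1) * catVal ‖yVal T ir.1‖) ^ ir.2 * (sqProd ir.1).coeff ir.2) := by
    intro ir
    have h := (hasSum_natGen (𝕜 := ℝ) (σ := ‖S / ((ir.1 : ℂ) + 1) ^ 2‖) (y := ‖yVal T ir.1‖)
      (by rw [norm_norm]; exact norm_div_sq_le hS _)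
      (by rw [norm_norm]; exact norm_yVal_le hT _) ir.2).mul_left
      (‖yVal T ir.1‖ * (((ir.1 : ℝ) + 1) ^ ir.2 * (sqProd ir.1).coeff ir.2))
    have e : (fun pq => ‖expTerm S T (ir, pq)‖) = fun x : ℕ × ℕ =>
        (‖yVal T ir.1‖ * (((ir.1 : ℝ) + 1) ^ ir.2 * (sqProd ir.1).coeff ir.2)) *
        (‖S / ((ir.1 : ℂ) + 1) ^ 2‖ ^ x.1 *
          (((PowerSeries.coeff x.2 (natGen x.1 ir.2) : ℕ) : ℝ) * ‖yVal T ir.1‖ ^ x.2)) := by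
      funext x
      simp only [expTerm, norm_mul, norm_pow, norm_neg, norm_natCast_add_one, Complex.norm_natCast,
        Complex.norm_real, Real.norm_of_nonneg (coeff_sqProd_nonneg _ _)]
    rw [e, h.tsum_eq, mul_pow]
    ring
  simp only [hin]
  have hd : ∀ i : ℕ, 3 / 4 ≤ 1 - ‖yVal T i‖ - ‖S / ((i : ℂ) + 1) ^ 2‖ := fun i => by
    linarith [norm_yVal_le hT i, norm_div_sq_le hS i]
  have hr : ∀ i : ℕ, HasSum (fun r : ℕ => ‖yVal T i‖ * ((2 + ‖yVal T i‖) /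
        (1 - ‖yVal T i‖ - ‖S / ((i : ℂ) + 1) ^ 2‖)) *
        ((((i : ℝ) + 1) * catVal ‖yVal T i‖) ^ r * (sqProd i).coeff r))
      (‖yVal T i‖ * ((2 + ‖yVal T i‖) / (1 - ‖yVal T i‖ - ‖S / ((i : ℂ) + 1) ^ 2‖)) *
        ∏ m ∈ Finset.range i, (1 + ((i : ℝ) + 1) * catVal ‖yVal T i‖ / ((m : ℝ) + 1)) ^ 2) :=
    fun i => (hasSum_sqProd (𝕜 := ℝ) i _).mul_left _
  refine (summable_prod_of_nonneg fun ir => ?_).2 ⟨fun i => (hr i).summable, ?_⟩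
  · have := hd ir.1
    have := coeff_sqProd_nonneg ir.1 ir.2
    have := catVal_nonneg (norm_nonneg (yVal T ir.1))
    have : 0 < 1 - ‖yVal T ir.1‖ - ‖S / ((ir.1 : ℂ) + 1) ^ 2‖ := by linarith
    simp only [Pi.zero_apply]
    positivity
  · simp only [(hr _).tsum_eq]
    refine Summable.of_nonneg_of_le (fun i => ?_) (fun i => ?_)
      (summable_inv_sq_succ.mul_left (3 * Real.exp 1))
    · have := hd i
      have : 0 < 1 - ‖yVal T i‖ - ‖S / ((i : ℂ) + 1) ^ 2‖ := by linarith
      have := catVal_nonneg (norm_nonneg (yVal T i))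
      positivity
    · have h1 : (2 + ‖yVal T i‖) / (1 - ‖yVal T i‖ - ‖S / ((i : ℂ) + 1) ^ 2‖) ≤ 3 := by
        rw [div_le_iff₀ (by linarith [hd i])]
        linarith [hd i, norm_yVal_le hT i]
      have hi : (1 : ℝ) ≤ (i : ℝ) + 1 := by linarith [(Nat.cast_nonneg i : (0 : ℝ) ≤ i)]
      have h2 : ‖yVal T i‖ ≤ (((i : ℝ) + 1) ^ 2)⁻¹ := by
        rw [norm_yVal, ← one_div]
        gcongr
        · linarith
        · norm_num
      have h3 := prod_one_add_sq_le hT i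
      have h4 : 0 ≤ (2 + ‖yVal T i‖) / (1 - ‖yVal T i‖ - ‖S / ((i : ℂ) + 1) ^ 2‖) :=
        div_nonneg (by positivity) (by linarith [hd i])
      calc _ ≤ (((i : ℝ) + 1) ^ 2)⁻¹ * 3 * Real.exp 1 := by
            have := catVal_nonneg (norm_nonneg (yVal T i))
            refine mul_le_mul (mul_le_mul h2 h1 h4 (by positivity)) h3 (by positivity)
              (by positivity)
        _ = _ := by ring

theorem hasSum_mainTerm_of_hasSum_expTerm {S T v : ℂ} (hS : ‖S‖ ≤ 1 / 8) (hT : ‖T‖ ≤ 1 / 8)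
    (h : HasSum (expTerm S T) v) : HasSum (mainTerm S T) v := by
  have h1 := h.prod_fiberwise fun ir =>
    (hasSum_natGen (norm_div_sq_le hS ir.1) (norm_yVal_le hT ir.1) ir.2).mul_left
      (yVal T ir.1 * ((-((ir.1 : ℂ) + 1)) ^ ir.2 * (((sqProd ir.1).coeff ir.2 : ℝ) : ℂ)))
  refine h1.prod_fiberwise fun i => ?_
  have h2 := (hasSum_sqProd (𝕜 := ℂ) i (-(((i : ℂ) + 1) * catVal (yVal T i)))).mul_left
    (yVal T i * (2 + yVal T i) / (1 - yVal T i - S / ((i : ℂ) + 1) ^ 2))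
  have e : mainTerm S T i = yVal T i * (2 + yVal T i) / (1 - yVal T i - S / ((i : ℂ) + 1) ^ 2) *
      ∏ m ∈ Finset.range i, (1 + -(((i : ℂ) + 1) * catVal (yVal T i)) / ((m : ℂ) + 1)) ^ 2 := by
    rw [mainTerm]
    congr 1
    exact Finset.prod_congr rfl fun m _ => by rw [neg_div, sub_eq_add_neg]
  rw [e]
  refine h2.congr_fun fun r => ?_
  rw [neg_pow ((i : ℂ) + 1), neg_pow (((i : ℂ) + 1) * _), mul_pow]
  simp only [Complex.coe_algebraMap, RCLike.ofReal, div_eq_mul_inv]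
  ring

/-! ### Collecting the coefficient of a monomial in S and T -/

/-- The candidate for the coefficient of `S^p T^q`. -/
def taylorCoeff (p q : ℕ) : ℂ :=
  if q = 0 then if p = 0 then 1 else 0
  else ∑ r ∈ Finset.range q, (-1 : ℂ) ^ r * (C (p : ℤ) q r : ℂ) * (Z (2 * p + 3 * q - r) r : ℂ)

theorem hasSum_expTerm_fixed_degree {S T : ℂ} (hS : ‖S‖ ≤ 1 / 8) (hT : ‖T‖ ≤ 1 / 8) (p q : ℕ) :
    HasSum (fun ir : ℕ × ℕ => expTerm S T (ir, (p, q)))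
      (taylorCoeff p (q + 1) * S ^ p * T ^ (q + 1)) := by
  have hs : Summable (fun ri : ℕ × ℕ => expTerm S T (ri.swap, (p, q))) := by
    have h1 := (Equiv.prodComm (ℕ × ℕ) (ℕ × ℕ)).summable_iff.2 (summable_expTerm hS hT)
    exact (Equiv.prodComm ℕ ℕ).summable_iff.2 (h1.prod_factor (p, q))
  have hi : ∀ r : ℕ, HasSum (fun i : ℕ => expTerm S T ((i, r), (p, q)))
      (if r ∈ Finset.range (q + 1) then (-1 : ℂ) ^ r * (C (p : ℤ) (q + 1) r : ℂ) *
        (Z (2 * p + 3 * (q + 1) - r) r : ℂ) * S ^ p * T ^ (q + 1) else 0) := by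
    intro r
    split_ifs with hr
    · have hr' : r < q + 1 := Finset.mem_range.1 hr
      have hZ := (Complex.hasSum_ofReal.2 (hasSum_Z (2 * p + 3 * (q + 1) - r) r (by omega))).mul_left
        ((-1 : ℂ) ^ r * (C (p : ℤ) (q + 1) r : ℂ) * S ^ p * T ^ (q + 1))
      rw [show ((-1 : ℂ) ^ r * (C (p : ℤ) (q + 1) r : ℂ) *
          (Z (2 * p + 3 * (q + 1) - r) r : ℂ) * S ^ p * T ^ (q + 1)) =
        ((-1 : ℂ) ^ r * (C (p : ℤ) (q + 1) r : ℂ) * S ^ p * T ^ (q + 1)) *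
          (Z (2 * p + 3 * (q + 1) - r) r : ℂ) by ring]
      refine hZ.congr_fun fun i => ?_
      have hn : ((i : ℂ) + 1) ≠ 0 := by exact_mod_cast Nat.succ_ne_zero i
      obtain ⟨k, hk⟩ : ∃ k, 2 * p + 3 * (q + 1) = k + r := ⟨_, (Nat.sub_add_cancel (by omega)).symm⟩
      -- The factor `n ^ r` from `a ^ r = (n x) ^ r` lowers the exponent `2p + 3q` of the largest
      -- variable to `2p + 3q - r`.
      have hpow : ((i : ℂ) + 1) ^ k * (i + 1) ^ r = ((i + 1) ^ 2) ^ p * ((i + 1) ^ 3) ^ (q + 1) := by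
        rw [← pow_add, ← hk, pow_add, pow_mul, pow_mul]
      rw [C_succ_eq_natCast, hk, Nat.add_sub_cancel]
      simp only [expTerm, yVal, neg_pow ((i : ℂ) + 1), div_pow]
      push_cast
      have : (((i : ℂ) + 1) ^ k)⁻¹ = (i + 1) ^ r / (((i + 1) ^ 2) ^ p * ((i + 1) ^ 3) ^ (q + 1)) := by
        rw [← hpow]; field_simp
      rw [this]
      field_simp
      ring
    · have : ∀ i : ℕ, expTerm S T ((i, r), (p, q)) = 0 := fun i => by
        rw [expTerm, coeff_natGen_of_lt p q r (by simpa using hr)]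
        simp
      simp only [this]
      exact hasSum_zero
  have h1 : HasSum (fun ri : ℕ × ℕ => expTerm S T (ri.swap, (p, q)))
      (taylorCoeff p (q + 1) * S ^ p * T ^ (q + 1)) := by
    have h2 := hs.hasSum.prod_fiberwise hi
    have h3 : HasSum (fun r => if r ∈ Finset.range (q + 1) then
        (-1 : ℂ) ^ r * (C (p : ℤ) (q + 1) r : ℂ) *
        (Z (2 * p + 3 * (q + 1) - r) r : ℂ) * S ^ p * T ^ (q + 1) else 0)
        (taylorCoeff p (q + 1) * S ^ p * T ^ (q + 1)) := by
      have : taylorCoeff p (q + 1) * S ^ p * T ^ (q + 1) = ∑ r ∈ Finset.range (q + 1),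
          if r ∈ Finset.range (q + 1) then (-1 : ℂ) ^ r * (C (p : ℤ) (q + 1) r : ℂ) *
            (Z (2 * p + 3 * (q + 1) - r) r : ℂ) * S ^ p * T ^ (q + 1) else 0 := by
        rw [taylorCoeff, if_neg (Nat.succ_ne_zero q), Finset.sum_mul, Finset.sum_mul]
        exact Finset.sum_congr rfl fun r hr => (if_pos hr).symm
      rw [this]
      exact hasSum_sum_of_ne_finset_zero fun r hr => if_neg hr
    rw [← h2.unique h3]
    exact hs.hasSum
  exact (Equiv.prodComm ℕ ℕ).hasSum_iff.1 h1

theorem hasSum_taylorCoeff {s t u : ℂ} (h : s + t + u = 0) (hs : ‖s‖ < 1 / 8) (ht : ‖t‖ < 1 / 8)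
    (hu : ‖u‖ < 1 / 8) :
    HasSum (fun x : ℕ × ℕ =>
      taylorCoeff x.1 x.2 * (s ^ 2 + s * t + t ^ 2) ^ x.1 * (-(s * t * u)) ^ x.2) (Vcl s t u) := by
  have hS : ‖s ^ 2 + s * t + t ^ 2‖ ≤ 1 / 8 := by
    calc _ ≤ ‖s ^ 2‖ + ‖s * t‖ + ‖t ^ 2‖ := norm_add₃_le
      _ = ‖s‖ ^ 2 + ‖s‖ * ‖t‖ + ‖t‖ ^ 2 := by simp
      _ ≤ _ := by nlinarith [norm_nonneg s, norm_nonneg t]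
  have hT : ‖-(s * t * u)‖ ≤ 1 / 8 := by
    rw [norm_neg, norm_mul, norm_mul]
    have h1 : ‖s‖ * ‖t‖ ≤ 1 := by nlinarith [norm_nonneg s, norm_nonneg t]
    nlinarith [norm_nonneg u]
  set S := s ^ 2 + s * t + t ^ 2 with hSdef
  set T := -(s * t * u) with hTdef
  have hsum := (summable_expTerm hS hT).hasSum
  have hV : Vcl s t u = 1 + ∑' x, expTerm S T x := by
    rw [← (hasSum_mainTerm_of_hasSum_expTerm hS hT hsum).tsum_eq]
    exact tendsto_nhds_unique
      (tendsto_prod_Vcl h (by linarith) (by linarith) (by linarith)) (tendsto_prod_one_add hS hT)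
  have h1 := ((Equiv.prodComm (ℕ × ℕ) (ℕ × ℕ)).hasSum_iff.2 hsum).prod_fiberwise
    (fun pq => hasSum_expTerm_fixed_degree hS hT pq.1 pq.2)
  -- The overall factor `yVal` raises the `T`-degree by one, so the expansion covers exactly the
  -- degrees `q ≥ 1`.
  have hinj : Function.Injective (fun x : ℕ × ℕ => (x.1, x.2 + 1)) := fun x y hxy => by
    simp only [Prod.mk.injEq, Nat.add_right_cancel_iff] at hxy
    exact Prod.ext hxy.1 hxy.2
  have h2 : HasSum (fun x : ℕ × ℕ => if x.2 = 0 then 0 else taylorCoeff x.1 x.2 * S ^ x.1 * T ^ x.2)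
      (∑' x, expTerm S T x) := by
    rw [← hinj.hasSum_iff]
    · simpa [Function.comp_def] using h1
    · rintro ⟨p, q⟩ hx
      rcases q with _ | q
      · rfl
      · exact absurd ⟨(p, q), rfl⟩ hx
  have h3 : HasSum (fun x : ℕ × ℕ => if x = (0, 0) then (1 : ℂ) else 0) 1 :=
    hasSum_ite_eq (0, 0) 1
  rw [hV]
  refine (h3.add h2).congr_fun fun x => ?_
  obtain ⟨p, q⟩ := x
  rcases q with _ | q
  · rcases p with _ | p <;> simp [taylorCoeff]
  · simp

theorem isTaylorCoeffs_taylorCoeff : IsTaylorCoeffs taylorCoeff :=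
  ⟨1 / 8, by norm_num, fun _ _ _ h hs ht hu => hasSum_taylorCoeff h hs ht hu⟩

/-! ### Uniqueness of the Taylor coefficients -/

theorem coeff_eq_zero_of_hasSum_zero {a : ℕ → ℂ} {δ : ℝ} (hδ : 0 < δ)
    (h : ∀ z : ℂ, ‖z‖ < δ → HasSum (fun n => a n * z ^ n) 0) (n : ℕ) : a n = 0 := by
  have h1 : HasFPowerSeriesAt (0 : ℂ → ℂ) (FormalMultilinearSeries.ofScalars ℂ a) 0 := by
    rw [hasFPowerSeriesAt_iff]
    filter_upwards [Metric.ball_mem_nhds (0 : ℂ) hδ] with z hz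
    simpa [mul_comm] using h z (by simpa using hz)
  rw [← FormalMultilinearSeries.coeff_ofScalars (p := a) (n := n), h1.eq_zero]
  rfl

theorem coeff_eq_zero_of_hasSum_zero₂ {d : ℕ → ℕ → ℂ} {δ : ℝ} (hδ : 0 < δ)
    (h : ∀ S T : ℂ, ‖S‖ < δ → ‖T‖ < δ →
      HasSum (fun x : ℕ × ℕ => d x.1 x.2 * S ^ x.1 * T ^ x.2) 0) (p q : ℕ) : d p q = 0 := by
  have hT : ∀ T : ℂ, ‖T‖ < δ → ∀ p, ∑' q, d p q * T ^ q = 0 := fun T hT =>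
    coeff_eq_zero_of_hasSum_zero hδ fun S hS => by
      have h1 := h S T hS hT
      have h2 := h1.prod_fiberwise fun p => (h1.summable.prod_factor p).hasSum
      refine h2.congr_fun fun p => ?_
      rw [← tsum_mul_right]
      exact tsum_congr fun q => by ring
  refine coeff_eq_zero_of_hasSum_zero (a := d p) hδ (fun T hT' => ?_) q
  rw [← hT T hT' p]
  refine Summable.hasSum ?_
  -- Vanishing of the `tsum` does not give convergence; this comes from the double series at a
  -- nonzero `S`.
  have hS0 : ((δ / 2 : ℝ) : ℂ) ≠ 0 := by
    rw [Complex.ofReal_ne_zero]; positivity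
  have h1 := (h ((δ / 2 : ℝ) : ℂ) T (by
    rw [Complex.norm_real, Real.norm_of_nonneg (by positivity)]; linarith) hT').summable.prod_factor p
  have h2 := h1.mul_left ((((δ / 2 : ℝ) : ℂ) ^ p)⁻¹)
  refine h2.congr fun q => ?_
  field_simp

theorem norm_lt_of_cubic_root {S T z : ℂ} {ε : ℝ} (hε : 0 < ε) (hS : ‖S‖ < ε ^ 2 / 2)
    (hT : ‖T‖ < ε ^ 3 / 2) (hz : z ^ 3 = S * z - T) : ‖z‖ < ε := by
  by_contra! hle
  have h1 : ‖z‖ ^ 3 ≤ ‖S‖ * ‖z‖ + ‖T‖ := by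
    rw [← norm_pow, hz, ← norm_mul]; exact norm_sub_le _ _
  have h2 : ε ^ 2 ≤ ‖z‖ ^ 2 := by gcongr
  have h3 : ε ^ 3 ≤ ‖z‖ ^ 3 := by gcongr
  have h4 : ‖S‖ * ‖z‖ ≤ ‖z‖ ^ 2 / 2 * ‖z‖ := by gcongr; linarith
  nlinarith

/-- `s, t, u` are the roots of `z³ - Sz + T`, and roots of a cubic with small coefficients are
small. -/
theorem exists_parameters {S T : ℂ} {ε : ℝ} (hε : 0 < ε) (hS : ‖S‖ < ε ^ 2 / 2)
    (hT : ‖T‖ < ε ^ 3 / 2) : ∃ s t u : ℂ, s + t + u = 0 ∧ ‖s‖ < ε ∧ ‖t‖ < ε ∧ ‖u‖ < ε ∧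
      s ^ 2 + s * t + t ^ 2 = S ∧ -(s * t * u) = T := by
  obtain ⟨s, hs⟩ : ∃ s : ℂ, s ^ 3 = S * s - T := by
    obtain ⟨s, hs⟩ := IsAlgClosed.exists_root
      (Polynomial.X ^ 3 - Polynomial.C S * Polynomial.X + Polynomial.C T) (by
        have : (Polynomial.X ^ 3 - Polynomial.C S * Polynomial.X + Polynomial.C T).degree = 3 := by
          compute_degree!
        rw [this]; norm_num)
    refine ⟨s, ?_⟩
    simp only [Polynomial.IsRoot, Polynomial.eval_add, Polynomial.eval_sub, Polynomial.eval_mul,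
      Polynomial.eval_pow, Polynomial.eval_X, Polynomial.eval_C] at hs
    linear_combination hs
  obtain ⟨t, ht⟩ : ∃ t : ℂ, s ^ 2 + s * t + t ^ 2 = S := by
    -- `4S - 3s²` is the discriminant of `t² + st + s² - S` in `t`.
    obtain ⟨w, hw⟩ := IsAlgClosed.exists_pow_nat_eq (4 * S - 3 * s ^ 2) (n := 2) (by norm_num)
    exact ⟨(w - s) / 2, by linear_combination hw / 4⟩
  refine ⟨s, t, -s - t, by ring, norm_lt_of_cubic_root hε hS hT hs,
    norm_lt_of_cubic_root hε hS hT ?_, norm_lt_of_cubic_root hε hS hT ?_, ht, ?_⟩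
  · linear_combination hs + (t - s) * ht
  · linear_combination hs + (-s - t - s) * ht
  · linear_combination (-1 : ℂ) * hs + s * ht

theorem IsTaylorCoeffs.unique {e e' : ℕ → ℕ → ℂ} (he : IsTaylorCoeffs e)
    (he' : IsTaylorCoeffs e') (p q : ℕ) : e p q = e' p q := by
  obtain ⟨ε₁, h₁, H₁⟩ := he
  obtain ⟨ε₂, h₂, H₂⟩ := he'
  set ε := min ε₁ ε₂ with hε'
  have hε : 0 < ε := lt_min h₁ h₂
  have h := coeff_eq_zero_of_hasSum_zero₂ (d := fun p q => e p q - e' p q)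
    (δ := min (ε ^ 2 / 2) (ε ^ 3 / 2)) (by positivity) (fun S T hS hT => by
      obtain ⟨s, t, u, hsum, hs, ht, hu, rfl, rfl⟩ :=
        exists_parameters hε (hS.trans_le (min_le_left _ _)) (hT.trans_le (min_le_right _ _))
      have a := H₁ s t u hsum (hs.trans_le (min_le_left _ _)) (ht.trans_le (min_le_left _ _))
        (hu.trans_le (min_le_left _ _))
      have b := H₂ s t u hsum (hs.trans_le (min_le_right _ _)) (ht.trans_le (min_le_right _ _))
        (hu.trans_le (min_le_right _ _))
      have c := a.sub b
      rw [sub_self] at c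
      refine c.congr_fun fun x => ?_
      ring) p q
  exact sub_eq_zero.1 h

/-! ### Integral combinations of the special multiple zeta values -/

theorem Z_mem_span (p q r : ℕ) (hr : r < q) :
    (Z (2 * p + 3 * q - r) r : ℂ) ∈ Submodule.span ℤ (specialMZVs p q) := by
  rw [Z, Complex.ofReal_sum]
  refine Submodule.sum_mem _ fun c hc => ?_
  have h1 : (mzv (c.blocks ++ [2 * p + 3 * q - r]) : ℂ) ∈ Submodule.span ℤ (specialMZVs p q) := by
    refine Submodule.subset_span ⟨c.blocks, _, (Finset.mem_filter.1 hc).2, ?_, ?_, ?_, rfl⟩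
    · rw [c.blocks_sum]; omega
    · have := c.length_le
      rw [c.blocks_length]
      omega
    · omega
  have h2 := Submodule.smul_mem _ ((2 : ℤ) ^ c.blocks.count 1) h1
  rw [zsmul_eq_mul] at h2
  push_cast at h2 ⊢
  exact h2

theorem taylorCoeff_mem_span (p q : ℕ) (hq : 1 ≤ q) :
    taylorCoeff p q ∈ Submodule.span ℤ (specialMZVs p q) := by
  obtain ⟨q, rfl⟩ := Nat.exists_eq_add_of_le' hq
  rw [taylorCoeff, if_neg (Nat.succ_ne_zero q)]
  refine Submodule.sum_mem _ fun r hr => ?_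
  have h := Submodule.smul_mem _ ((-1 : ℤ) ^ r * (PowerSeries.coeff q (natGen p r) : ℕ))
    (Z_mem_span p (q + 1) r (Finset.mem_range.1 hr))
  rw [zsmul_eq_mul] at h
  rw [C_succ_eq_natCast]
  push_cast at h ⊢
  exact h

end Virasoro

end

theorem theorem1 :
    (∃ e : ℕ → ℕ → ℂ, Virasoro.IsTaylorCoeffs e) ∧
    ∀ e : ℕ → ℕ → ℂ, Virasoro.IsTaylorCoeffs e →
      (∀ p : ℕ, e p 0 = if p = 0 then 1 else 0) ∧
      ∀ p q : ℕ, 1 ≤ q →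
        e p q ∈ Submodule.span ℤ (Virasoro.specialMZVs p q) ∧
        e p q = ∑ r ∈ Finset.range q,
          (-1 : ℂ) ^ r * (Virasoro.C (p : ℤ) q r : ℂ) * (Virasoro.Z (2 * p + 3 * q - r) r : ℂ) ∧
        ∀ r < q, ∃ c : ℤ, Virasoro.C (p : ℤ) q r = c := by
  refine ⟨⟨_, Virasoro.isTaylorCoeffs_taylorCoeff⟩, fun e he => ?_⟩
  have h := he.unique Virasoro.isTaylorCoeffs_taylorCoeff
  refine ⟨fun p => ?_, fun p q hq => ⟨?_, ?_, fun r _ => ?_⟩⟩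
  · rw [h, Virasoro.taylorCoeff, if_pos rfl]
  · rw [h]
    exact Virasoro.taylorCoeff_mem_span p q hq
  · rw [h, Virasoro.taylorCoeff, if_neg (by omega)]
  · obtain ⟨q, rfl⟩ := Nat.exists_eq_add_of_le' hq
    exact ⟨(PowerSeries.coeff q (Virasoro.natGen p r) : ℕ), by
      rw [Virasoro.C_succ_eq_natCast, Int.cast_natCast]⟩
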